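/- **Model.** Let $f:\mathbb{N}_0\to(0,\infty)$ and let $(m_n)_{n\ge1}$ be a sequence of positive integers; put $s_0=0$, $s_n=m_1+\dots+m_n$. The graph $\mathcal{G}^*_0$ consists of one vertex $v_0$ and no edges. For $n\ge 1$ and $s_{n-1}<k\le s_n$, the multigraph $\mathcal{G}^*_k$ on the vertices $v_0,\dots,v_n$ is obtained from $\mathcal{G}^*_{k-1}$ (after adding the new vertex $v_n$ when $k=s_{n-1}+1$) by adding an edge directed from $v_n$ to a random vertex among $v_0,\dots,v_{n-1}$, where, conditionally on $\mathcal{G}^*_0,\dots,\mathcal{G}^*_{k-1}$, the vertex $v_i$ is chosen with probability $$\frac{f(d_i(k-1))}{\sum_{j=0}^{n-1}f(d_j(k-1))},$$ $d_i(k-1)$ being the degree (in-degree plus out-degree) of $v_i$ in $\mathcal{G}^*_{k-1}$. Let $\mathcal{G}_n=\mathcal{G}^*_{s_n}$. A *persistent hub emerges almost surely* in a random graph sequence $(G_n)_{n\ge 0}$ if, almost surely, there are a vertex $v$ and a finite $n_0$ (both random) such that for every $n\ge n_0$ the vertex $v$ is the unique vertex of maximal degree in $G_n$. Finally let $\Phi_1(l)=\sum_{i=0}^{l-1}1/f(i)$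 for $l\in\mathbb{N}_0$, extended to $[0,\infty)$ by linear interpolation, and let $\Phi_1^{-1}$ be its inverse. **Theorem.** Let $f(k)=(k+1)^{\alpha}$, $k\in\mathbb{N}_0$, with $\alpha\in(1/2,1)$, and $m_n=\lfloor 1+(\log n)^{\nu}\rfloor$, $n\ge1$, with $\nu>0$. Then, for every such $\alpha$ and every $\nu>0$, a persistent hub emerges almost surely, both in $(\mathcal{G}_n)_{n\ge0}$ and in $(\mathcal{G}^*_k)_{k\ge0}$. This holds although, for every $\theta'>0$ with $\theta'/(1-\alpha)<\nu$, $$\lim_{n\to\infty}\frac{m_n}{\Phi_1^{-1}\big((\log n)^{\theta'}\big)}=\infty .$$ -/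

import Mathlib

/-! Generalized attachment model with attachment function `f` and (deterministic) attachment
sequence `m i`, `i ≥ 1` (the value `m 0` is never used). -/

namespace AttachmentModel

/-- A finite directed multigraph with vertices `v_0, …, v_{order - 1}`, written `0, …, order - 1`;
an edge from `v_a` to `v_b` is recorded as the pair `(a, b)`. -/
structure MultiDigraph where
  order : ℕ
  edges : Multiset (ℕ × ℕ)

/-- The degree of a vertex: out-degree plus in-degree, with multiplicity. -/
def MultiDigraph.degree (G : MultiDigraph) (v : ℕ) : ℕ :=
  G.edges.countP (fun e => e.1 = v) + G.edges.countP (fun e => e.2 = v)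

/-- `v` is the unique vertex of maximal degree of `G`. -/
def MultiDigraph.IsHub (G : MultiDigraph) (v : ℕ) : Prop :=
  v < G.order ∧ ∀ w, w < G.order → w ≠ v → G.degree w < G.degree v

/-- From some finite time on, one and the same vertex is the unique vertex of maximal degree. -/
def HasPersistentHub (G : ℕ → MultiDigraph) : Prop :=
  ∃ v n₀ : ℕ, ∀ n, n₀ ≤ n → (G n).IsHub v

/-- `s_n = m_1 + … + m_n`, the number of edges after the arrival of `v_n`; `s_0 = 0`. -/
def edgeCount (m : ℕ → ℕ) (n : ℕ) : ℕ := ∑ i ∈ Finset.Icc 1 n, m i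

/-- The index of the vertex that brings the `k`-th edge: for `k ≥ 1` and `m ≥ 1` it is the only
`n` with `s_{n-1} < k ≤ s_n`; it is `0` for `k = 0`. -/
noncomputable def source (m : ℕ → ℕ) (k : ℕ) : ℕ := sInf {n | k ≤ edgeCount m n}

/-- The graph with `k` attached edges, when for every `j ≥ 1` the `j`-th edge leads from
`v_{source m j}` to `v_{h j}` (the value `h 0` is never used). -/
noncomputable def edgeGraph (m h : ℕ → ℕ) (k : ℕ) : MultiDigraph where
  order := source m k + 1
  edges := (Finset.Icc 1 k).val.map fun j => (source m j, h j)

/-- The graph after the arrival of `v_n` and the attachment of all its `m_n` edges. -/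
noncomputable def vertexGraph (m h : ℕ → ℕ) (n : ℕ) : MultiDigraph :=
  edgeGraph m h (edgeCount m n)

/-- The probability with which the edge number `k + 1` is attached to the vertex `v_i`,
`i < source m (k + 1)`, when the heads of the first `k` edges are `h 1, …, h k`. -/
noncomputable def attachProb (f : ℕ → ℝ) (m h : ℕ → ℕ) (k i : ℕ) : ℝ :=
  f ((edgeGraph m h k).degree i) /
    ∑ j ∈ Finset.range (source m (k + 1)), f ((edgeGraph m h k).degree j)

/-- The random sequence `T` of edge heads (`T j` is the head of the `j`-th edge, `j ≥ 1`) has the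
law of the attachment model: given the first `k` edges, hence the graphs with at most
`k` edges, the next edge is attached to one of the vertices `v_i` that are older than its
source, with probability proportional to `f (degree of v_i)`. -/
structure IsAttachmentProcess {Ω : Type*} [MeasurableSpace Ω] (μ : MeasureTheory.Measure Ω)
    (f : ℕ → ℝ) (m : ℕ → ℕ) (T : ℕ → Ω → ℕ) : Prop where
  measurable : ∀ k, Measurable (T k)
  cond_eq : ∀ (k : ℕ) (h : ℕ → ℕ), μ {ω | ∀ j ∈ Finset.Icc 1 k, T j ω = h j} ≠ 0 →
    ∀ i, i < source m (k + 1) →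
      ProbabilityTheory.cond μ {ω | ∀ j ∈ Finset.Icc 1 k, T j ω = h j} {ω | T (k + 1) ω = i} =
        ENNReal.ofReal (attachProb f m h k i)

/-- `Φ₁(l) = ∑_{i < l} 1 / f(i)` at integers `l ≥ 0`, interpolated linearly to `x ≥ 0`. -/
noncomputable def phiOne (f : ℕ → ℝ) (x : ℝ) : ℝ :=
  ∑ i ∈ Finset.range ⌊x⌋₊, 1 / f i + (x - ⌊x⌋₊) / f ⌊x⌋₊

/-- The inverse of `Φ₁ : [0, ∞) → [0, ∞)` (a bijection when `f > 0` and `∑ 1 / f(i) = ∞`). -/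
noncomputable def phiOneInv (f : ℕ → ℝ) : ℝ → ℝ :=
  Function.invFunOn (phiOne f) (Set.Ici 0)

open MeasureTheory ProbabilityTheory in
/-- The model exists, for every positive `f` and every `ℕ`-valued sequence `m ≥ 1`. -/
theorem exists_isAttachmentProcess (f : ℕ → ℝ) (hf : ∀ k, 0 < f k) (m : ℕ → ℕ)
    (hm : ∀ n, 1 ≤ n → 1 ≤ m n) :
    ∃ (μ : Measure (ℕ → ℕ)) (T : ℕ → (ℕ → ℕ) → ℕ),
      IsProbabilityMeasure μ ∧ IsAttachmentProcess μ f m T := by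
  classical
  have hs : ∀ k, 0 < source m (k + 1) := by
    intro k
    have hne : {n | k + 1 ≤ edgeCount m n}.Nonempty := by
      refine ⟨k + 1, ?_⟩
      have := Finset.card_nsmul_le_sum (Finset.Icc 1 (k + 1)) m 1
        (fun n hn => hm n (Finset.mem_Icc.1 hn).1)
      simpa [edgeCount] using this
    have hmem : k + 1 ≤ edgeCount m (source m (k + 1)) := Nat.sInf_mem hne
    rcases Nat.eq_zero_or_pos (source m (k + 1)) with h0 | h0
    · rw [h0] at hmem
      simp [edgeCount] at hmem
    · exact h0
  have hsum : ∀ k h, ∑ i ∈ Finset.range (source m (k + 1)),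
      ENNReal.ofReal (attachProb f m h k i) = 1 := by
    intro k h
    have hpos : 0 < ∑ j ∈ Finset.range (source m (k + 1)), f ((edgeGraph m h k).degree j) :=
      Finset.sum_pos (fun _ _ => hf _) ⟨0, Finset.mem_range.2 (hs k)⟩
    rw [← ENNReal.ofReal_sum_of_nonneg]
    · simp only [attachProb]
      rw [← Finset.sum_div, div_self hpos.ne', ENNReal.ofReal_one]
    · intro i _
      exact div_nonneg (hf _).le hpos.le
  have hcongr : ∀ k h h', (∀ j ∈ Finset.Icc 1 k, h j = h' j) → ∀ i,
      attachProb f m h k i = attachProb f m h' k i := by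
    intro k h h' hh i
    have : edgeGraph m h k = edgeGraph m h' k := by
      simp only [edgeGraph, MultiDigraph.mk.injEq, true_and]
      refine Multiset.map_congr rfl fun j hj => ?_
      rw [hh j hj]
    simp only [attachProb, this]
  let ext : (k : ℕ) → ((i : Finset.Iic k) → ℕ) → ℕ → ℕ :=
    fun k x j => if hj : j ∈ Finset.Iic k then x ⟨j, hj⟩ else 0
  let κ : (k : ℕ) → Kernel ((i : Finset.Iic k) → ℕ) ℕ := fun k =>
    ⟨fun x => ∑ i ∈ Finset.range (source m (k + 1)),
      ENNReal.ofReal (attachProb f m (ext k x) k i) • Measure.dirac i,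
      measurable_of_countable _⟩
  have hκ : ∀ k x, κ k x = ∑ i ∈ Finset.range (source m (k + 1)),
      ENNReal.ofReal (attachProb f m (ext k x) k i) • Measure.dirac i := fun _ _ => rfl
  have : ∀ k, IsMarkovKernel (κ k) := fun k => ⟨fun x => ⟨by
    rw [hκ]; simpa using hsum k (ext k x)⟩⟩
  have hκi : ∀ k x i, i < source m (k + 1) →
      κ k x {i} = ENNReal.ofReal (attachProb f m (ext k x) k i) := by
    intro k x i hi
    rw [hκ]
    simp [Set.indicator_apply, hi]
  let P : Measure (ℕ → ℕ) := Kernel.trajMeasure (X := fun _ => ℕ) (Measure.dirac 0) κ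
  have : IsProbabilityMeasure P := by
    change IsProbabilityMeasure (Kernel.trajMeasure (X := fun _ => ℕ) (Measure.dirac 0) κ)
    infer_instance
  refine ⟨P, fun k x => x k, inferInstance, fun k => measurable_pi_apply k, ?_⟩
  intro k h hne i hi
  have key := Kernel.map_frestrictLe_trajMeasure_compProd_eq_map_trajMeasure
    (X := fun _ => ℕ) (μ₀ := Measure.dirac 0) (κ := κ) (a := k)
  let S : Set ((i : Finset.Iic k) → ℕ) := {x | ∀ j ∈ Finset.Icc 1 k, ext k x j = h j}
  have hS : MeasurableSet S := S.to_countable.measurableSet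
  have hpre : (Preorder.frestrictLe (π := fun _ => ℕ) k) ⁻¹' S =
      {ω : ℕ → ℕ | ∀ j ∈ Finset.Icc 1 k, ω j = h j} := by
    ext ω
    simp only [S, ext, Set.mem_preimage, Set.mem_ofPred_eq]
    refine forall₂_congr fun j hj => ?_
    have : j ∈ Finset.Iic k := Finset.mem_Iic.2 (Finset.mem_Icc.1 hj).2
    rw [dif_pos this]
    rfl
  have hmeas : Measurable (Preorder.frestrictLe (π := fun _ => ℕ) k) := by fun_prop
  have hmeas2 : Measurable (fun x : ℕ → ℕ =>
      (Preorder.frestrictLe (π := fun _ => ℕ) k x, x (k + 1))) := by fun_prop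
  have hpast : MeasurableSet {ω : ℕ → ℕ | ∀ j ∈ Finset.Icc 1 k, ω j = h j} := by
    rw [← hpre]; exact hmeas hS
  have key2 := congrArg (fun ρ => ρ (S ×ˢ {i})) key
  rw [Measure.compProd_apply_prod hS (measurableSet_singleton i),
    Measure.map_apply hmeas2 (hS.prod (measurableSet_singleton i)),
    setLIntegral_congr_fun (g := fun _ => ENNReal.ofReal (attachProb f m h k i)) hS
      (fun x hx => by rw [hκi k x i hi, hcongr k _ h hx]),
    setLIntegral_const, Measure.map_apply hmeas hS, hpre] at key2
  have hset : (fun x : ℕ → ℕ => (Preorder.frestrictLe (π := fun _ => ℕ) k x, x (k + 1))) ⁻¹'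
      (S ×ˢ {i}) = {ω : ℕ → ℕ | ∀ j ∈ Finset.Icc 1 k, ω j = h j} ∩ {ω | ω (k + 1) = i} := by
    rw [← hpre]; rfl
  rw [hset] at key2
  rw [cond_apply hpast]
  change (P _)⁻¹ * P _ = _
  rw [show P ({ω : ℕ → ℕ | ∀ j ∈ Finset.Icc 1 k, ω j = h j} ∩ {ω | ω (k + 1) = i}) = _
    from key2.symm, mul_left_comm]
  change _ * ((P _)⁻¹ * P _) = _
  rw [ENNReal.inv_mul_cancel hne (measure_ne_top _ _), mul_one]

end AttachmentModel

/-!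
Write `d i k` for the degree of `v_i` after `k` edges, `S k` for the normaliser of the attachment
probabilities and `s n` for `edgeCount m n`. From time `s i` on, `d i` jumps from `a` to `a + 1`
with conditional probability `f a / S k`. Hence a function `G (d i) (d j)` of two degrees is a
martingale as soon as
`f a * (G (a + 1) b - G a b) + f b * (G a (b + 1) - G a b) = 0`,
whatever `S` is (`martingale_of_harmonic`). In particular, for every real or complex `z`, this holds
for the product `∏_{l < a} (1 + z / f l) * ∏_{l < b} (1 - z / f l)`. The proof uses two values
of `z`.

*Ties* (`ae_eventually_degree_ne`). For `z = i t` the product is bounded in modulus by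
`R = ∏_l (1 + (t / f l) ^ 2)`, which is finite because `α > 1 / 2`. If `v_i` and `v_j` tie
infinitely often and their degrees tend to infinity, its limit is `R`. Choosing `t` large depending
on `k` makes its value at time `k` at most `R / 2` in modulus, so the conditional probability at
time `k` of infinitely many ties is at most `3 / 4`; by Lévy's upward theorem this event is null.

*Late vertices* (`measure_catch_up_le`). For `z = 1 / 2` the product `growth a * decay b` is
positive, and at least some `r > 0` when `a ≥ b`. By Ville's inequality the probability that
`v_{n+1}` ever catches up with `v_0` is at most of the order of
`growth (m (n + 1)) * 𝔼[decay (d 0 (s n))]`. Moreover `𝔼[decay (d 0 k)]` is at most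
`exp (-(1/2) ∑_{l < k} 1 / w l)` for any deterministic bound `w` of `S` (`integral_decay_le`), which
also shows that all degrees tend to infinity (`ae_tendsto_degree`). As `f` is sublinear, `S` is
of order at most `n (m n) ^ α` while `v_n` is being attached, so that
`∑_{l < s n} 1 / w l` has order at least `∑_{j ≤ n} (m j) ^ (1 - α) / j`, hence at least
`(log n) ^ (1 + ν (1 - α))`, whereas `growth (m n)` is the exponential of
`O((log n) ^ (ν (1 - α)))`. The bounds are summable (`summable_growth_mul_exp`), and by the
Borel-Cantelli lemma only finitely many vertices ever catch up with `v_0`.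

Degrees change by at most one in each step, so once the finitely many remaining vertices have
stopped tying their order is frozen, and the leader is a persistent hub
(`hasPersistentHub_of_no_ties`).

The limit of `m n / Φ₁⁻¹ ((log n) ^ θ)` follows from `Φ₁⁻¹ y = O(y ^ (1 / (1 - α)))`
(`phiOneInv_bounds`).
-/

namespace AttachmentModel

open MeasureTheory ProbabilityTheory Filter Topology

/-! ### Sources and degrees -/

lemma edgeCount_succ (m : ℕ → ℕ) (n : ℕ) :
    edgeCount m (n + 1) = edgeCount m n + m (n + 1) :=
  Finset.sum_Icc_succ_top (by omega) m

lemma edgeCount_mono (m : ℕ → ℕ) : Monotone (edgeCount m) :=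
  monotone_nat_of_le_succ fun n => by rw [edgeCount_succ]; omega

lemma le_edgeCount {m : ℕ → ℕ} (hm : ∀ n, 1 ≤ n → 1 ≤ m n) (n : ℕ) : n ≤ edgeCount m n := by
  induction n with
  | zero => omega
  | succ n ih => rw [edgeCount_succ]; have := hm (n + 1) (by omega); omega

lemma source_le_iff {m : ℕ → ℕ} (hm : ∀ n, 1 ≤ n → 1 ≤ m n) {k n : ℕ} :
    source m k ≤ n ↔ k ≤ edgeCount m n := by
  constructor
  · intro h
    have hmem : k ≤ edgeCount m (source m k) :=
      Nat.sInf_mem (s := {n | k ≤ edgeCount m n}) ⟨k, le_edgeCount hm k⟩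
    exact hmem.trans (edgeCount_mono m h)
  · exact fun h => Nat.sInf_le h

lemma lt_source_iff {m : ℕ → ℕ} (hm : ∀ n, 1 ≤ n → 1 ≤ m n) {k n : ℕ} :
    n < source m k ↔ edgeCount m n < k := by
  rw [← not_le, source_le_iff hm, not_le]

lemma lt_source_succ_iff {m : ℕ → ℕ} (hm : ∀ n, 1 ≤ n → 1 ≤ m n) {k n : ℕ} :
    n < source m (k + 1) ↔ edgeCount m n ≤ k := by
  rw [lt_source_iff hm, Nat.lt_succ_iff]

lemma degree_zero (m h : ℕ → ℕ) (v : ℕ) : (edgeGraph m h 0).degree v = 0 := by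
  simp [edgeGraph, MultiDigraph.degree]

lemma degree_succ (m h : ℕ → ℕ) (k v : ℕ) :
    (edgeGraph m h (k + 1)).degree v = (edgeGraph m h k).degree v +
      (if source m (k + 1) = v then 1 else 0) + (if h (k + 1) = v then 1 else 0) := by
  have hI : (Finset.Icc 1 (k + 1)).val = (k + 1) ::ₘ (Finset.Icc 1 k).val := by
    rw [← Finset.insert_Icc_right_eq_Icc_add_one (by omega), Finset.insert_val_of_notMem (by simp)]
  simp only [edgeGraph, MultiDigraph.degree, hI, Multiset.map_cons, Multiset.countP_cons]
  split_ifs <;> omega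

lemma edgeGraph_congr {m h h' : ℕ → ℕ} {k : ℕ} (hh : ∀ j ∈ Finset.Icc 1 k, h j = h' j) :
    edgeGraph m h k = edgeGraph m h' k := by
  simp only [edgeGraph, MultiDigraph.mk.injEq, true_and]
  refine Multiset.map_congr rfl fun j hj => ?_
  rw [hh j hj]

lemma degree_mono (m h : ℕ → ℕ) (v : ℕ) : Monotone fun k => (edgeGraph m h k).degree v :=
  monotone_nat_of_le_succ fun k => by simp only [degree_succ m h k v]; omega

lemma degree_le (m h : ℕ → ℕ) (k v : ℕ) : (edgeGraph m h k).degree v ≤ 2 * k := by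
  induction k with
  | zero => simp [degree_zero]
  | succ k ih => rw [degree_succ]; split_ifs <;> omega

/-- Each edge is counted at most twice in the sum of the degrees. -/
lemma sum_degree_le (m h : ℕ → ℕ) (k N : ℕ) :
    ∑ v ∈ Finset.range N, (edgeGraph m h k).degree v ≤ 2 * k := by
  induction k with
  | zero => simp [degree_zero]
  | succ k ih =>
    simp only [degree_succ, Finset.sum_add_distrib, Finset.sum_ite_eq]
    split_ifs <;> omega

/-- Once all its own edges are attached, a vertex gains degree only as a head. -/
lemma degree_succ_of_le {m : ℕ → ℕ} (hm : ∀ n, 1 ≤ n → 1 ≤ m n) (h : ℕ → ℕ) {k v : ℕ}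
    (hk : edgeCount m v ≤ k) :
    (edgeGraph m h (k + 1)).degree v =
      (edgeGraph m h k).degree v + (if h (k + 1) = v then 1 else 0) := by
  rw [degree_succ, if_neg ((lt_source_succ_iff hm).2 hk).ne', add_zero]

/-- While its own edges are being attached, `v_{n+1}` has no other edges, because heads are older
than sources. -/
lemma degree_le_of_le {m : ℕ → ℕ} (hm : ∀ n, 1 ≤ n → 1 ≤ m n) {h : ℕ → ℕ}
    (hh : ∀ k, h (k + 1) < source m (k + 1)) {n k : ℕ} (hk : k ≤ edgeCount m (n + 1)) :
    (edgeGraph m h k).degree (n + 1) ≤ k - edgeCount m n := by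
  induction k with
  | zero => simp [degree_zero]
  | succ k ih =>
    have h1 := ih (by omega)
    have h2 := hh k
    have h3 : source m (k + 1) ≤ n + 1 := (source_le_iff hm).2 hk
    rw [degree_succ, if_neg (show h (k + 1) ≠ n + 1 by omega)]
    split_ifs with h4
    · have := (lt_source_iff hm (n := n) (k := k + 1)).1 (by omega)
      omega
    · omega

/-- If every late vertex stays behind `v_0` and no two vertices tie infinitely often, then there is
a persistent hub: after the last tie of the finitely many remaining vertices their order is
frozen, because degrees change by at most one in each step. -/
lemma hasPersistentHub_of_no_ties {m : ℕ → ℕ} (hm : ∀ n, 1 ≤ n → 1 ≤ m n) {h : ℕ → ℕ}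
    (hlate : ∃ n₁, ∀ n, n₁ ≤ n → ∀ k, edgeCount m n ≤ k →
      (edgeGraph m h k).degree (n + 1) < (edgeGraph m h k).degree 0)
    (htie : ∀ i j, i ≠ j → ∃ K, ∀ k, K ≤ k →
      (edgeGraph m h k).degree i ≠ (edgeGraph m h k).degree j) :
    HasPersistentHub (edgeGraph m h) := by
  obtain ⟨n₁, hlate⟩ := hlate
  choose! K hK using htie
  set s := Finset.range (n₁ + 1)
  obtain ⟨K₀, hK₀⟩ : ∃ K₀, ∀ i ∈ s, ∀ j ∈ s, K i j ≤ K₀ := by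
    refine ⟨s.sup fun i => s.sup fun j => K i j, fun i hi j hj => ?_⟩
    exact (Finset.le_sup (f := fun j => K i j) hj).trans
      (Finset.le_sup (f := fun i => s.sup fun j => K i j) hi)
  set k₀ := max K₀ (edgeCount m n₁)
  obtain ⟨v, hv, hmax⟩ := Finset.exists_max_image s (fun i => (edgeGraph m h k₀).degree i)
    ⟨0, by simp [s]⟩
  have hsrc : ∀ i ∈ s, ∀ k, k₀ ≤ k → edgeCount m i ≤ k := fun i hi k hk =>
    (edgeCount_mono m (Nat.lt_succ_iff.1 (Finset.mem_range.1 hi))).trans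
      ((le_max_right _ _).trans hk)
  have hlead : ∀ k, k₀ ≤ k → ∀ w ∈ s, w ≠ v →
      (edgeGraph m h k).degree w < (edgeGraph m h k).degree v := by
    intro k hk w hw hwv
    have hne : ∀ k, k₀ ≤ k → (edgeGraph m h k).degree w ≠ (edgeGraph m h k).degree v :=
      fun k hk => hK w v hwv k (((hK₀ w hw v hv).trans (le_max_left _ _)).trans hk)
    induction k, hk using Nat.le_induction with
    | base => exact lt_of_le_of_ne (hmax w hw) (hne k₀ le_rfl)
    | succ k hk ih =>
      have h1 := hne (k + 1) (by omega)
      rw [degree_succ_of_le hm h (hsrc w hw k hk), degree_succ_of_le hm h (hsrc v hv k hk)] at h1 ⊢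
      split_ifs at h1 ⊢ <;> omega
  refine ⟨v, k₀, fun k hk => ⟨?_, fun w hw hwv => ?_⟩⟩
  · rcases Nat.eq_zero_or_pos v with rfl | hv0
    · exact Nat.succ_pos _
    · have h1 : v - 1 < source m k := by
        rw [lt_source_iff hm]
        obtain ⟨v, rfl⟩ : ∃ u, v = u + 1 := ⟨v - 1, by omega⟩
        have h2 := hsrc _ hv k hk
        have := hm (v + 1) (by omega)
        rw [edgeCount_succ] at h2
        simp only [Nat.add_sub_cancel]
        omega
      change v < source m k + 1
      omega
  · by_cases hws : w ∈ s
    · exact hlead k hk w hws hwv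
    · have hw1 : n₁ + 1 ≤ w := by simpa [s] using hws
      obtain ⟨n, rfl⟩ : ∃ n, w = n + 1 := ⟨w - 1, by omega⟩
      have hn : n < source m k := by
        have : n + 1 < source m k + 1 := hw
        omega
      have h0 := hlate n (by omega) k ((lt_source_iff hm).1 hn).le
      rcases eq_or_ne 0 v with rfl | h0v
      · exact h0
      · exact h0.trans (hlead k hk 0 (by simp [s]) h0v)

lemma vertexGraph_hasPersistentHub {m h : ℕ → ℕ} (hm : ∀ n, 1 ≤ n → 1 ≤ m n)
    (hub : HasPersistentHub (edgeGraph m h)) : HasPersistentHub (vertexGraph m h) := by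
  obtain ⟨v, n₀, hv⟩ := hub
  exact ⟨v, n₀, fun n hn => hv _ (hn.trans (le_edgeCount hm n))⟩

section RandomHeads

/-! ### One step of the attachment process -/

variable {Ω : Type*} {f : ℕ → ℝ} {m : ℕ → ℕ} {T : ℕ → Ω → ℕ}

/-- The degree of `v` after the attachment of `k` edges. -/
noncomputable def degreeProcess (m : ℕ → ℕ) (T : ℕ → Ω → ℕ) (v k : ℕ) (ω : Ω) : ℕ :=
  (edgeGraph m (fun j => T j ω) k).degree v

/-- The denominator of the attachment probabilities of the edge `k + 1`. -/
noncomputable def totalWeight (f : ℕ → ℝ) (m : ℕ → ℕ) (T : ℕ → Ω → ℕ) (k : ℕ)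
    (ω : Ω) : ℝ :=
  ∑ v ∈ Finset.range (source m (k + 1)), f (degreeProcess m T v k ω)

lemma totalWeight_pos (hf : ∀ k, 0 < f k) (hm : ∀ n, 1 ≤ n → 1 ≤ m n) (k : ℕ) (ω : Ω) :
    0 < totalWeight f m T k ω :=
  Finset.sum_pos (fun _ _ => hf _)
    ⟨0, Finset.mem_range.2 ((lt_source_succ_iff hm).2 (by simp [edgeCount]))⟩

lemma le_totalWeight (hf : ∀ k, 0 < f k) {k i : ℕ} (hi : i < source m (k + 1)) (ω : Ω) :
    f (degreeProcess m T i k ω) ≤ totalWeight f m T k ω :=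
  Finset.single_le_sum (f := fun v => f (degreeProcess m T v k ω)) (fun _ _ => (hf _).le)
    (Finset.mem_range.2 hi)

lemma degreeProcess_le (m : ℕ → ℕ) (T : ℕ → Ω → ℕ) (v k : ℕ) (ω : Ω) :
    degreeProcess m T v k ω ≤ 2 * k := degree_le _ _ _ _

lemma degreeProcess_mono (m : ℕ → ℕ) (T : ℕ → Ω → ℕ) (v : ℕ) (ω : Ω) :
    Monotone fun k => degreeProcess m T v k ω := degree_mono _ _ _

lemma degreeProcess_succ (hm : ∀ n, 1 ≤ n → 1 ≤ m n) {v k : ℕ} (hk : edgeCount m v ≤ k) (ω : Ω) :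
    degreeProcess m T v (k + 1) ω =
      degreeProcess m T v k ω + if T (k + 1) ω = v then 1 else 0 :=
  degree_succ_of_le hm _ hk

/-- The σ-algebra at time `k` is generated by the heads of the edges `1, …, k`; the unused variable
`T 0` is left out. -/
def historyFiltration [mΩ : MeasurableSpace Ω] (T : ℕ → Ω → ℕ)
    (hT : ∀ k, Measurable (T k)) : Filtration ℕ mΩ where
  seq k := MeasurableSpace.comap (fun ω (j : Finset.Icc 1 k) => T j ω) ⊤
  mono' := by
    intro k l hkl
    have : (fun ω (j : Finset.Icc 1 k) => T j ω) =
        (fun (x : Finset.Icc 1 l → ℕ) (j : Finset.Icc 1 k) =>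
          x ⟨j, Finset.Icc_subset_Icc_right hkl j.2⟩) ∘ fun ω (j : Finset.Icc 1 l) => T j ω := rfl
    simp only [this, ← MeasurableSpace.comap_comp]
    exact MeasurableSpace.comap_mono le_top
  le' := by
    intro k
    rintro _ ⟨S, -, rfl⟩
    have : Measurable (fun ω (j : Finset.Icc 1 k) => T j ω) :=
      measurable_pi_lambda _ fun j => hT j
    exact this S.to_countable.measurableSet

variable [mΩ : MeasurableSpace Ω] {μ : Measure Ω}

lemma measurable_of_history (hT : ∀ k, Measurable (T k)) {β : Type*} [MeasurableSpace β] {k : ℕ}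
    {F : (ℕ → ℕ) → β} (hF : ∀ h h' : ℕ → ℕ, (∀ j ∈ Finset.Icc 1 k, h j = h' j) → F h = F h') :
    Measurable[historyFiltration T hT k] fun ω => F fun j => T j ω := by
  have : (fun ω => F fun j => T j ω) =
      (fun x : Finset.Icc 1 k → ℕ => F fun j => if hj : j ∈ Finset.Icc 1 k then x ⟨j, hj⟩ else 0) ∘
        fun ω (j : Finset.Icc 1 k) => T j ω := by
    ext ω
    refine hF _ _ fun j hj => ?_
    simp only [dif_pos hj]
  rw [this]
  exact (measurable_from_top).comp (comap_measurable _)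

lemma measurable_degreeProcess (hT : ∀ k, Measurable (T k)) (m : ℕ → ℕ) (v k : ℕ) :
    Measurable[historyFiltration T hT k] (degreeProcess m T v k) :=
  measurable_of_history hT (F := fun h => (edgeGraph m h k).degree v)
    fun _ _ hh => by rw [edgeGraph_congr hh]

lemma measurable_totalWeight (hT : ∀ k, Measurable (T k)) (f : ℕ → ℝ) (m : ℕ → ℕ) (k : ℕ) :
    Measurable[historyFiltration T hT k] (totalWeight f m T k) :=
  measurable_of_history hT
    (F := fun h => ∑ v ∈ Finset.range (source m (k + 1)), f ((edgeGraph m h k).degree v))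
    fun _ _ hh => by simp only [edgeGraph_congr hh]

lemma integrable_degreeProcess [IsProbabilityMeasure μ] (hT : ∀ k, Measurable (T k)) (m : ℕ → ℕ)
    (G : ℕ → ℕ → ℝ) (i j k : ℕ) :
    Integrable (fun ω => G (degreeProcess m T i k ω) (degreeProcess m T j k ω)) μ := by
  refine Integrable.of_bound (C := ∑ a ∈ Finset.range (2 * k + 1),
    ∑ b ∈ Finset.range (2 * k + 1), ‖G a b‖) ?_ (ae_of_all _ fun ω => ?_)
  · have h1 := (measurable_degreeProcess hT m i k).mono ((historyFiltration T hT).le k) le_rfl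
    have h2 := (measurable_degreeProcess hT m j k).mono ((historyFiltration T hT).le k) le_rfl
    exact ((measurable_of_countable (fun x : ℕ × ℕ => G x.1 x.2)).comp
      (h1.prodMk h2)).aestronglyMeasurable
  · have h1 := Finset.mem_range.2 (Nat.lt_succ_of_le (degreeProcess_le m T i k ω))
    have h2 := Finset.mem_range.2 (Nat.lt_succ_of_le (degreeProcess_le m T j k ω))
    exact (Finset.single_le_sum (f := fun b => ‖G (degreeProcess m T i k ω) b‖)
      (fun _ _ => norm_nonneg _) h2).trans
      (Finset.single_le_sum (f := fun a => ∑ b ∈ Finset.range (2 * k + 1), ‖G a b‖)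
        (fun _ _ => Finset.sum_nonneg fun _ _ => norm_nonneg _) h1)

/-- The attachment rule as a conditional expectation. -/
lemma condExp_head [IsProbabilityMeasure μ] (hT : IsAttachmentProcess μ f m T)
    (hf : ∀ k, 0 < f k) (hm : ∀ n, 1 ≤ n → 1 ≤ m n) {k i : ℕ} (hi : i < source m (k + 1)) :
    (fun ω => f (degreeProcess m T i k ω) / totalWeight f m T k ω) =ᵐ[μ]
      μ[{ω | T (k + 1) ω = i}.indicator fun _ => (1 : ℝ) |
        historyFiltration T hT.measurable k] := by
  set ℱ := historyFiltration T hT.measurable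
  set g : Ω → ℝ := fun ω => f (degreeProcess m T i k ω) / totalWeight f m T k ω
  have hgm : Measurable[ℱ k] g :=
    ((measurable_from_top (f := f)).comp (measurable_degreeProcess hT.measurable m i k)).div
      (measurable_totalWeight hT.measurable f m k)
  have hg0 : ∀ ω, 0 ≤ g ω := fun ω => div_nonneg (hf _).le (totalWeight_pos hf hm k ω).le
  have hg1 : ∀ ω, g ω ≤ 1 := fun ω =>
    div_le_one_of_le₀ (le_totalWeight hf hi ω) (totalWeight_pos hf hm k ω).le
  have hgint : Integrable g μ := Integrable.of_bound (C := 1)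
    (hgm.mono (ℱ.le k) le_rfl).aestronglyMeasurable
    (ae_of_all _ fun ω => by rw [Real.norm_of_nonneg (hg0 ω)]; exact hg1 ω)
  have hTi : MeasurableSet {ω | T (k + 1) ω = i} := hT.measurable _ (measurableSet_singleton i)
  set H : Ω → (Finset.Icc 1 k → ℕ) := fun ω j => T j ω
  have hH : Measurable H := measurable_pi_lambda _ fun j => hT.measurable j
  -- Two measures on the countable set of histories that agree on singletons.
  have hmeas : (μ.restrict {ω | T (k + 1) ω = i}).map H =
      (μ.withDensity fun ω => ENNReal.ofReal (g ω)).map H := by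
    refine Measure.ext_of_singleton fun x => ?_
    have hx : MeasurableSet (H ⁻¹' {x}) := hH (measurableSet_singleton x)
    rw [Measure.map_apply hH (measurableSet_singleton x),
      Measure.map_apply hH (measurableSet_singleton x), Measure.restrict_apply hx,
      withDensity_apply _ hx]
    set h : ℕ → ℕ := fun j => if hj : j ∈ Finset.Icc 1 k then x ⟨j, hj⟩ else 0
    have hHx : H ⁻¹' {x} = {ω | ∀ j ∈ Finset.Icc 1 k, T j ω = h j} := by
      ext ω
      simp only [Set.mem_preimage, Set.mem_singleton_iff, Set.mem_ofPred_eq, H, h, funext_iff,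
        Subtype.forall]
      exact forall₂_congr fun j hj => by rw [dif_pos hj]
    have hgx : ∀ ω ∈ H ⁻¹' {x}, ENNReal.ofReal (g ω) = ENNReal.ofReal (attachProb f m h k i) := by
      intro ω hω
      rw [hHx] at hω
      have : edgeGraph m (fun j => T j ω) k = edgeGraph m h k := edgeGraph_congr hω
      simp only [g, attachProb, degreeProcess, totalWeight, this]
    rw [setLIntegral_congr_fun hx hgx, setLIntegral_const]
    by_cases h0 : μ (H ⁻¹' {x}) = 0
    · rw [h0, mul_zero, measure_inter_null_of_null_left _ h0]
    · rw [hHx] at h0 hx ⊢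
      rw [← hT.cond_eq k h h0 i hi, cond_apply hx, mul_assoc, mul_comm, mul_assoc,
        ENNReal.mul_inv_cancel h0 (measure_ne_top _ _), mul_one]
  refine ae_eq_condExp_of_forall_setIntegral_eq (ℱ.le k)
    ((integrable_const (1 : ℝ)).indicator hTi) (fun s _ _ => hgint.integrableOn) ?_
    hgm.stronglyMeasurable.aestronglyMeasurable
  rintro _ ⟨S, -, rfl⟩ -
  have hS : MeasurableSet S := S.to_countable.measurableSet
  have key := congrArg (fun ρ => ρ S) hmeas
  simp only [Measure.map_apply hH hS, Measure.restrict_apply (hH hS),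
    withDensity_apply _ (hH hS)] at key
  change ∫ ω in H ⁻¹' S, g ω ∂μ = ∫ ω in H ⁻¹' S, _ ∂μ
  rw [integral_indicator_const _ hTi, integral_eq_lintegral_of_nonneg_ae (ae_of_all _ hg0)
    hgint.integrableOn.aestronglyMeasurable, ← key, smul_eq_mul, mul_one, measureReal_def,
    Measure.restrict_apply hTi, Set.inter_comm]

/-- Almost surely every edge leads to an older vertex. -/
lemma ae_head_lt [IsProbabilityMeasure μ] (hT : IsAttachmentProcess μ f m T)
    (hf : ∀ k, 0 < f k) (hm : ∀ n, 1 ≤ n → 1 ≤ m n) :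
    ∀ᵐ ω ∂μ, ∀ k, T (k + 1) ω < source m (k + 1) := by
  rw [ae_all_iff]
  intro k
  set ℱ := historyFiltration T hT.measurable
  have hTi : ∀ i, MeasurableSet {ω | T (k + 1) ω = i} := fun i =>
    hT.measurable _ (measurableSet_singleton i)
  have hint : ∀ i, Integrable (fun ω => f (degreeProcess m T i k ω) / totalWeight f m T k ω) μ ∨
      source m (k + 1) ≤ i := fun i => by
    rcases lt_or_ge i (source m (k + 1)) with hi | hi
    · exact Or.inl (integrable_condExp.congr (condExp_head hT hf hm hi).symm)
    · exact Or.inr hi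
  have h1 : ∑ i ∈ Finset.range (source m (k + 1)), μ.real {ω | T (k + 1) ω = i} = 1 := by
    have h2 : ∀ i ∈ Finset.range (source m (k + 1)), μ.real {ω | T (k + 1) ω = i} =
        ∫ ω, f (degreeProcess m T i k ω) / totalWeight f m T k ω ∂μ := by
      intro i hi
      rw [integral_congr_ae (condExp_head hT hf hm (Finset.mem_range.1 hi)),
        integral_condExp (ℱ.le k), integral_indicator_const _ (hTi i), smul_eq_mul, mul_one]
    rw [Finset.sum_congr rfl h2, ← integral_finsetSum]
    · have : ∀ ω, ∑ i ∈ Finset.range (source m (k + 1)),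
          f (degreeProcess m T i k ω) / totalWeight f m T k ω = 1 := fun ω => by
        rw [← Finset.sum_div]
        exact div_self (totalWeight_pos hf hm k ω).ne'
      simp [this]
    · exact fun i hi => (hint i).resolve_right (by simpa using hi)
  have h3 : μ.real (⋃ i ∈ Finset.range (source m (k + 1)), {ω | T (k + 1) ω = i}) = 1 := by
    rw [measureReal_biUnion_finset _ fun i _ => hTi i, h1]
    intro i _ j _ hij
    exact Set.disjoint_left.2 fun ω hi hj => hij (hi.symm.trans hj)
  have h4 : {ω | T (k + 1) ω < source m (k + 1)} =
      ⋃ i ∈ Finset.range (source m (k + 1)), {ω | T (k + 1) ω = i} := by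
    ext ω; simp
  rw [← h4, measureReal_def, ENNReal.toReal_eq_one_iff] at h3
  exact mem_ae_iff_prob_eq_one (h4 ▸ Finset.measurableSet_biUnion _ fun i _ => hTi i) |>.2 h3

/-- The expected gain of a vertex in one step, weighted with a function `Δ` of two degrees. -/
lemma condExp_head_mul [IsProbabilityMeasure μ] (hT : IsAttachmentProcess μ f m T)
    (hf : ∀ k, 0 < f k) (hm : ∀ n, 1 ≤ n → 1 ≤ m n) {k i : ℕ} (hi : edgeCount m i ≤ k)
    (Δ : ℕ → ℕ → ℝ) (j : ℕ) :
    μ[fun ω => Δ (degreeProcess m T i k ω) (degreeProcess m T j k ω) *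
        {ω | T (k + 1) ω = i}.indicator (fun _ => (1 : ℝ)) ω | historyFiltration T hT.measurable k]
      =ᵐ[μ] fun ω => Δ (degreeProcess m T i k ω) (degreeProcess m T j k ω) *
        (f (degreeProcess m T i k ω) / totalWeight f m T k ω) := by
  set ℱ := historyFiltration T hT.measurable
  have hTi : MeasurableSet {ω | T (k + 1) ω = i} := hT.measurable _ (measurableSet_singleton i)
  have hind : Integrable ({ω | T (k + 1) ω = i}.indicator fun _ => (1 : ℝ)) μ :=
    (integrable_const _).indicator hTi
  have h1 := measurable_degreeProcess hT.measurable m i k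
  have h2 := measurable_degreeProcess hT.measurable m j k
  have hmeas : Measurable[ℱ k]
      fun ω => Δ (degreeProcess m T i k ω) (degreeProcess m T j k ω) :=
    (measurable_of_countable fun x : ℕ × ℕ => Δ x.1 x.2).comp (h1.prodMk h2)
  have hprod : Integrable ((fun ω => Δ (degreeProcess m T i k ω) (degreeProcess m T j k ω)) *
      {ω | T (k + 1) ω = i}.indicator fun _ => (1 : ℝ)) μ := by
    refine ((integrable_degreeProcess hT.measurable m Δ i j k).indicator hTi).congr
      (ae_of_all _ fun ω => ?_)
    by_cases h : T (k + 1) ω = i <;> simp [Set.indicator, h]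
  filter_upwards [condExp_mul_of_stronglyMeasurable_left hmeas.stronglyMeasurable hprod hind,
    condExp_head hT hf hm ((lt_source_succ_iff hm).2 hi)] with ω h3 h4
  rw [Pi.mul_apply] at h3
  rw [h4]
  exact h3

/-! ### Martingales of the degrees of two vertices -/

/-- The filtration of the heads, restarted after `k₀` edges. -/
def restartedFiltration (T : ℕ → Ω → ℕ) (hT : ∀ k, Measurable (T k)) (k₀ : ℕ) :
    Filtration ℕ mΩ where
  seq n := historyFiltration T hT (k₀ + n)
  mono' _ _ h := (historyFiltration T hT).mono (Nat.add_le_add_left h k₀)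
  le' n := (historyFiltration T hT).le (k₀ + n)

/-- The unknown normaliser enters the drifts of the two degrees in the same way, so a function of
the degrees that is harmonic for the two rates `f a` and `f b` is a martingale. -/
lemma martingale_of_harmonic [IsProbabilityMeasure μ] (hT : IsAttachmentProcess μ f m T)
    (hf : ∀ k, 0 < f k) (hm : ∀ n, 1 ≤ n → 1 ≤ m n) {G : ℕ → ℕ → ℝ}
    (hG : ∀ a b, f a * (G (a + 1) b - G a b) + f b * (G a (b + 1) - G a b) = 0)
    {i j k₀ : ℕ} (hij : i ≠ j) (hi : edgeCount m i ≤ k₀) (hj : edgeCount m j ≤ k₀) :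
    Martingale (fun n ω => G (degreeProcess m T i (k₀ + n) ω) (degreeProcess m T j (k₀ + n) ω))
      (restartedFiltration T hT.measurable k₀) μ := by
  refine martingale_nat (fun n => ?_)
    (fun n => integrable_degreeProcess hT.measurable m G i j (k₀ + n)) fun n => ?_
  · exact Measurable.stronglyMeasurable ((measurable_of_countable fun x : ℕ × ℕ => G x.1 x.2).comp
      ((measurable_degreeProcess hT.measurable m i (k₀ + n)).prodMk
        (measurable_degreeProcess hT.measurable m j (k₀ + n))))
  set k := k₀ + n
  change _ =ᵐ[μ] μ[_ | historyFiltration T hT.measurable k]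
  set ℱ := historyFiltration T hT.measurable
  have hik : edgeCount m i ≤ k := by omega
  have hjk : edgeCount m j ≤ k := by omega
  set A : Ω → ℝ := fun ω => G (degreeProcess m T i k ω) (degreeProcess m T j k ω)
  set B : Ω → ℝ := fun ω => (fun a b => G (a + 1) b - G a b) (degreeProcess m T i k ω)
    (degreeProcess m T j k ω) * {ω | T (k + 1) ω = i}.indicator (fun _ => (1 : ℝ)) ω
  set C : Ω → ℝ := fun ω => (fun b a => G a (b + 1) - G a b) (degreeProcess m T j k ω)
    (degreeProcess m T i k ω) * {ω | T (k + 1) ω = j}.indicator (fun _ => (1 : ℝ)) ω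
  have hTi : ∀ i, MeasurableSet {ω | T (k + 1) ω = i} := fun i =>
    hT.measurable _ (measurableSet_singleton i)
  have hstep : (fun ω => G (degreeProcess m T i (k₀ + (n + 1)) ω)
      (degreeProcess m T j (k₀ + (n + 1)) ω)) = A + (B + C) := by
    ext ω
    change G (degreeProcess m T i (k + 1) ω) (degreeProcess m T j (k + 1) ω) =
      A ω + (B ω + C ω)
    simp only [degreeProcess_succ hm hik, degreeProcess_succ hm hjk, A, B, C]
    by_cases h1 : T (k + 1) ω = i
    · have h2 : T (k + 1) ω ≠ j := fun h => hij (h1.symm.trans h)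
      simp [h1, hij, Set.indicator]
    · by_cases h2 : T (k + 1) ω = j
      · simp [h2, hij.symm, Set.indicator]
      · simp [h1, h2, Set.indicator]
  have hAint : Integrable A μ := integrable_degreeProcess hT.measurable m G i j k
  have hAmeas : StronglyMeasurable[ℱ k] A :=
    Measurable.stronglyMeasurable ((measurable_of_countable fun x : ℕ × ℕ => G x.1 x.2).comp
      ((measurable_degreeProcess hT.measurable m i k).prodMk
        (measurable_degreeProcess hT.measurable m j k)))
  have hBint : Integrable B μ := by
    refine ((integrable_degreeProcess hT.measurable m (fun a b => G (a + 1) b - G a b)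
      i j k).indicator (hTi i)).congr (ae_of_all _ fun ω => ?_)
    by_cases h : T (k + 1) ω = i <;> simp [B, Set.indicator, h]
  have hCint : Integrable C μ := by
    refine ((integrable_degreeProcess hT.measurable m (fun b a => G a (b + 1) - G a b)
      j i k).indicator (hTi j)).congr (ae_of_all _ fun ω => ?_)
    by_cases h : T (k + 1) ω = j <;> simp [C, Set.indicator, h]
  rw [hstep]
  filter_upwards [condExp_add hAint (hBint.add hCint) (ℱ k), condExp_add hBint hCint (ℱ k),
    condExp_head_mul hT hf hm hik (fun a b => G (a + 1) b - G a b) j,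
    condExp_head_mul hT hf hm hjk (fun b a => G a (b + 1) - G a b) i] with ω h1 h2 h3 h4
  rw [Pi.add_apply] at h1 h2
  rw [h1, h2, h3, h4, condExp_of_stronglyMeasurable (ℱ.le k) hAmeas hAint]
  have h5 := hG (degreeProcess m T i k ω) (degreeProcess m T j k ω)
  change A ω = A ω + _
  rw [left_eq_add, ← mul_div_assoc, ← mul_div_assoc, ← add_div, div_eq_zero_iff]
  exact Or.inl (by linarith)

/-! ### No two vertices tie infinitely often -/

/-- The product `∏_{l < d} (1 + i t / f l)`; up to a normalisation it is `exp (i t Φ₁ d)`. -/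
noncomputable def phase (f : ℕ → ℝ) (t : ℝ) (d : ℕ) : ℂ :=
  ∏ l ∈ Finset.range d, (1 + (t / f l : ℝ) * Complex.I)

/-- The squared modulus of `phase f t d`. -/
noncomputable def phaseSq (f : ℕ → ℝ) (t : ℝ) (d : ℕ) : ℝ :=
  ∏ l ∈ Finset.range d, (1 + (t / f l) ^ 2)

lemma norm_phase_sq (f : ℕ → ℝ) (t : ℝ) (d : ℕ) : ‖phase f t d‖ ^ 2 = phaseSq f t d := by
  rw [phase, phaseSq, norm_prod, ← Finset.prod_pow]
  refine Finset.prod_congr rfl fun l _ => ?_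
  rw [← Complex.normSq_eq_norm_sq, Complex.normSq_apply]
  simp
  ring

lemma phaseSq_mono (f : ℕ → ℝ) (t : ℝ) : Monotone (phaseSq f t) := by
  refine monotone_nat_of_le_succ fun d => ?_
  rw [phaseSq, phaseSq, Finset.prod_range_succ]
  exact le_mul_of_one_le_right (Finset.prod_nonneg fun _ _ => by positivity)
    (by linarith [sq_nonneg (t / f d)])

lemma exists_tendsto_phaseSq (hsum : Summable fun l => 1 / f l ^ 2) (t : ℝ) :
    ∃ R, 1 ≤ R ∧ (∀ d, phaseSq f t d ≤ R) ∧ Tendsto (phaseSq f t) atTop (𝓝 R) := by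
  have hbdd : BddAbove (Set.range (phaseSq f t)) := by
    refine ⟨Real.exp (t ^ 2 * ∑' l, 1 / f l ^ 2), ?_⟩
    rintro _ ⟨d, rfl⟩
    have h1 : phaseSq f t d ≤ ∏ l ∈ Finset.range d, Real.exp (t ^ 2 * (1 / f l ^ 2)) := by
      refine Finset.prod_le_prod (fun _ _ => by positivity) fun l _ => ?_
      have := Real.add_one_le_exp (t ^ 2 * (1 / f l ^ 2))
      rw [div_pow]
      linarith [mul_one_div (t ^ 2) (f l ^ 2)]
    refine h1.trans ?_
    rw [← Real.exp_sum, ← Finset.mul_sum]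
    exact Real.exp_le_exp.2 (mul_le_mul_of_nonneg_left
      (hsum.sum_le_tsum _ fun _ _ => by positivity) (sq_nonneg t))
  refine ⟨_, ?_, fun d => le_ciSup hbdd d, tendsto_atTop_ciSup (phaseSq_mono f t) hbdd⟩
  simpa [phaseSq] using le_ciSup hbdd 0

/-- The real part of `phase a * conj (phase b)`; it is maximal on the diagonal. -/
noncomputable def phaseCos (f : ℕ → ℝ) (t : ℝ) (a b : ℕ) : ℝ :=
  (phase f t a * (starRingEnd ℂ) (phase f t b)).re

lemma phaseCos_harmonic (hf : ∀ k, 0 < f k) (t : ℝ) (a b : ℕ) :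
    f a * (phaseCos f t (a + 1) b - phaseCos f t a b) +
      f b * (phaseCos f t a (b + 1) - phaseCos f t a b) = 0 := by
  have ha := (hf a).ne'
  have hb := (hf b).ne'
  simp only [phaseCos, phase, Finset.prod_range_succ, map_mul]
  generalize ∏ l ∈ Finset.range a, (1 + ((t / f l : ℝ) : ℂ) * Complex.I) = z
  generalize ∏ l ∈ Finset.range b, (1 + ((t / f l : ℝ) : ℂ) * Complex.I) = w
  simp [Complex.mul_re, Complex.mul_im, -Complex.ofReal_div]
  field_simp
  ring

lemma phaseCos_self (f : ℕ → ℝ) (t : ℝ) (d : ℕ) : phaseCos f t d d = phaseSq f t d := by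
  rw [phaseCos, Complex.mul_conj, Complex.ofReal_re, Complex.normSq_eq_norm_sq, norm_phase_sq]

lemma abs_phaseCos_le {t c : ℝ} {a b : ℕ} (ha : phaseSq f t a ≤ c)
    (hb : phaseSq f t b ≤ c) : |phaseCos f t a b| ≤ c := by
  refine (Complex.abs_re_le_norm _).trans ?_
  rw [norm_mul, RCLike.norm_conj]
  rw [← norm_phase_sq] at ha hb
  nlinarith [sq_nonneg (‖phase f t a‖ - ‖phase f t b‖)]

/-- Whatever happened so far, with conditional probability at least `1 / 4` there are only finitely
many ties. -/
lemma condExp_ties_le [IsProbabilityMeasure μ] (hT : IsAttachmentProcess μ f m T)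
    (hf : ∀ k, 0 < f k) (hm : ∀ n, 1 ≤ n → 1 ≤ m n) (hsum : Summable fun l => 1 / f l ^ 2)
    {i j k : ℕ} (hij : i ≠ j) (hi : edgeCount m i ≤ k) (hj : edgeCount m j ≤ k)
    (hinf : ∀ᵐ ω ∂μ, Tendsto (fun k => degreeProcess m T i k ω) atTop atTop)
    {B : Set Ω} (hB : B = {ω | ∃ᶠ k in atTop, degreeProcess m T i k ω = degreeProcess m T j k ω})
    (hBm : MeasurableSet B) :
    ∀ᵐ ω ∂μ, (μ[B.indicator fun _ => (1 : ℝ) | historyFiltration T hT.measurable k]) ω ≤ 3 / 4 := by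
  -- With this choice of `t` the tail product after time `k` is at least `2`.
  set t := f (2 * k)
  obtain ⟨R, hR1, hRle, hRlim⟩ := exists_tendsto_phaseSq hsum t
  have hhalf : ∀ a, a ≤ 2 * k → phaseSq f t a ≤ R / 2 := by
    intro a ha
    have h1 := phaseSq_mono f t ha
    have h2 := hRle (2 * k + 1)
    rw [phaseSq, Finset.prod_range_succ, div_self (hf _).ne'] at h2
    change phaseSq f t (2 * k) * _ ≤ R at h2
    linarith
  set ℱ := restartedFiltration T hT.measurable k
  set M : ℕ → Ω → ℝ := fun n ω =>
    phaseCos f t (degreeProcess m T i (k + n) ω) (degreeProcess m T j (k + n) ω)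
  have hM : Martingale M ℱ μ :=
    martingale_of_harmonic hT hf hm (phaseCos_harmonic hf t) hij hi hj
  have hMle : ∀ n ω, ‖M n ω‖ ≤ R := fun n ω => abs_phaseCos_le (hRle _) (hRle _)
  have hUI : UniformIntegrable M 1 μ := by
    refine uniformIntegrable_of le_rfl ENNReal.one_ne_top
      (fun n => (hM.integrable n).aestronglyMeasurable) fun ε _ => ⟨R.toNNReal + 1, fun n => ?_⟩
    have : {x | R.toNNReal + 1 ≤ ‖M n x‖₊} = ∅ := by
      refine Set.eq_empty_of_forall_notMem fun x hx => ?_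
      have h1 : (R.toNNReal : ℝ) + 1 ≤ ‖M n x‖ := by exact_mod_cast hx
      have h2 := hMle n x
      have h3 := Real.le_coe_toNNReal R
      linarith
    rw [this, Set.indicator_empty]
    simp
  set L := Filtration.limitProcess M ℱ μ
  have hlim := hM.submartingale.ae_tendsto_limitProcess_of_uniformIntegrable hUI
  have hcond : M 0 =ᵐ[μ] μ[L | ℱ 0] := hM.ae_eq_condExp_limitProcess hUI 0
  obtain ⟨C, hC⟩ := hUI.2.2
  have hLint : Integrable L μ :=
    (Filtration.memLp_limitProcess_of_eLpNorm_bdd hUI.1 hC).integrable le_rfl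
  have hBint : Integrable (B.indicator fun _ => (1 : ℝ)) μ := (integrable_const _).indicator hBm
  have hkey : (2 * R) • (B.indicator fun _ => (1 : ℝ)) ≤ᵐ[μ] L + fun _ => R := by
    filter_upwards [hlim, hinf] with ω h1 h2
    rw [Pi.smul_apply, smul_eq_mul, Pi.add_apply]
    by_cases hω : ω ∈ B
    · -- Along the ties the martingale takes the maximal values, so its limit is `R`.
      have h3 : Tendsto (fun n => phaseSq f t (degreeProcess m T i (k + n) ω)) atTop (𝓝 R) :=
        hRlim.comp (h2.comp (tendsto_atTop_mono (fun n => Nat.le_add_left n k) tendsto_id))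
      have h4 : ∃ᶠ n in atTop, M n ω - phaseSq f t (degreeProcess m T i (k + n) ω) = 0 := by
        rw [hB] at hω
        refine frequently_atTop.2 fun a => ?_
        obtain ⟨b, hb, hb'⟩ := frequently_atTop.1 hω (k + a)
        refine ⟨b - k, by omega, ?_⟩
        have : k + (b - k) = b := by omega
        simp only [M, this]
        rw [← hb', phaseCos_self, sub_self]
      have h5 : L ω - R = 0 := by
        have : L ω - R ∈ ({0} : Set ℝ) :=
          isClosed_singleton.mem_of_frequently_of_tendsto h4 (h1.sub h3)
        simpa using this
      rw [Set.indicator_of_mem hω]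
      linarith
    · rw [Set.indicator_of_notMem hω]
      have : -R ≤ L ω := ge_of_tendsto' h1 fun n => (abs_le.1 (hMle n ω)).1
      linarith
  have hmono := condExp_mono (m := ℱ 0) (hBint.smul (2 * R))
    (hLint.add (integrable_const R)) hkey
  filter_upwards [hmono, condExp_smul (2 * R) (B.indicator fun _ => (1 : ℝ)) (ℱ 0) (μ := μ),
    condExp_add hLint (integrable_const R) (ℱ 0), hcond] with ω h1 h2 h3 h4
  rw [h2, h3, Pi.smul_apply, Pi.add_apply, ← h4, condExp_const (ℱ.le 0), smul_eq_mul] at h1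
  have h5 : M 0 ω ≤ R / 2 :=
    (le_abs_self _).trans (abs_phaseCos_le (hhalf _ (degreeProcess_le _ _ _ _ _))
      (hhalf _ (degreeProcess_le _ _ _ _ _)))
  change (μ[B.indicator fun _ => (1 : ℝ) | ℱ 0]) ω ≤ 3 / 4
  nlinarith

theorem ae_eventually_degree_ne [IsProbabilityMeasure μ] (hT : IsAttachmentProcess μ f m T)
    (hf : ∀ k, 0 < f k) (hm : ∀ n, 1 ≤ n → 1 ≤ m n) (hsum : Summable fun l => 1 / f l ^ 2)
    {i j : ℕ} (hij : i ≠ j)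
    (hinf : ∀ᵐ ω ∂μ, Tendsto (fun k => degreeProcess m T i k ω) atTop atTop) :
    ∀ᵐ ω ∂μ, ∃ K, ∀ k, K ≤ k → degreeProcess m T i k ω ≠ degreeProcess m T j k ω := by
  set ℱ := historyFiltration T hT.measurable
  obtain ⟨B, hB⟩ : ∃ B : Set Ω,
      B = {ω | ∃ᶠ k in atTop, degreeProcess m T i k ω = degreeProcess m T j k ω} := ⟨_, rfl⟩
  have hBm : MeasurableSet[⨆ n, ℱ n] B := by
    have : B = ⋂ K, ⋃ k ≥ K, {ω | degreeProcess m T i k ω = degreeProcess m T j k ω} := by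
      ext ω
      simp [hB, frequently_atTop]
    rw [this]
    refine MeasurableSet.iInter fun K => MeasurableSet.iUnion fun k => MeasurableSet.iUnion
      fun _ => le_iSup (fun n => ℱ n) k _ ?_
    exact measurableSet_eq_fun (measurable_degreeProcess hT.measurable m i k)
      (measurable_degreeProcess hT.measurable m j k)
  have hle : (⨆ n, ℱ n) ≤ mΩ := iSup_le fun n => ℱ.le n
  have hbound : ∀ᵐ ω ∂μ, ∀ k, edgeCount m i + edgeCount m j ≤ k →
      (μ[B.indicator fun _ => (1 : ℝ) | ℱ k]) ω ≤ 3 / 4 := by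
    refine ae_all_iff.2 fun k => ?_
    by_cases hk : edgeCount m i + edgeCount m j ≤ k
    · filter_upwards [condExp_ties_le hT hf hm hsum hij (k := k) (by omega) (by omega) hinf hB
        (hle _ hBm)] with ω h _ using h
    · exact ae_of_all _ fun ω h => absurd h hk
  have hint : Integrable (B.indicator fun _ => (1 : ℝ)) μ :=
    (integrable_const _).indicator (hle _ hBm)
  have hsm : StronglyMeasurable[⨆ n, ℱ n] (B.indicator fun _ => (1 : ℝ)) :=
    stronglyMeasurable_const.indicator hBm
  filter_upwards [hbound, hint.tendsto_ae_condExp hsm] with ω h1 h2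
  have h3 : B.indicator (fun _ => (1 : ℝ)) ω ≤ 3 / 4 :=
    le_of_tendsto h2 (eventually_atTop.2 ⟨_, fun k hk => h1 k hk⟩)
  have h4 : ω ∉ B := fun h => by
    rw [Set.indicator_of_mem h] at h3
    norm_num at h3
  rw [hB] at h4
  have h5 := not_frequently.1 h4
  obtain ⟨K, hK⟩ := eventually_atTop.1 h5
  exact ⟨K, hK⟩

/-! ### Degrees tend to infinity -/

/-- The product `∏_{l < d} (1 + 1 / (2 f l))`, an exponential of `Φ₁ d / 2` up to constants. The
factor `1 / 2` keeps the companion `decay` positive when `1 ≤ f`. -/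
noncomputable def growth (f : ℕ → ℝ) (d : ℕ) : ℝ := ∏ l ∈ Finset.range d, (1 + 1 / 2 / f l)

/-- The product `∏_{l < d} (1 - 1 / (2 f l))`, an exponential of `-Φ₁ d / 2` up to constants. -/
noncomputable def decay (f : ℕ → ℝ) (d : ℕ) : ℝ := ∏ l ∈ Finset.range d, (1 - 1 / 2 / f l)

lemma half_div_le (hf : ∀ k, 1 ≤ f k) (l : ℕ) : 1 / 2 / f l ≤ 1 / 2 :=
  div_le_self (by norm_num) (hf l)

lemma half_div_nonneg (hf : ∀ k, 1 ≤ f k) (l : ℕ) : 0 ≤ 1 / 2 / f l :=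
  div_nonneg (by norm_num) (zero_le_one.trans (hf l))

lemma growth_succ (f : ℕ → ℝ) (d : ℕ) : growth f (d + 1) = growth f d * (1 + 1 / 2 / f d) :=
  Finset.prod_range_succ _ _

lemma decay_succ (f : ℕ → ℝ) (d : ℕ) : decay f (d + 1) = decay f d * (1 - 1 / 2 / f d) :=
  Finset.prod_range_succ _ _

lemma growth_pos (hf : ∀ k, 1 ≤ f k) (d : ℕ) : 0 < growth f d :=
  Finset.prod_pos fun l _ => by linarith [half_div_nonneg hf l]

lemma decay_pos (hf : ∀ k, 1 ≤ f k) (d : ℕ) : 0 < decay f d :=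
  Finset.prod_pos fun l _ => by linarith [half_div_le hf l]

lemma growth_mono (hf : ∀ k, 1 ≤ f k) : Monotone (growth f) :=
  monotone_nat_of_le_succ fun d => by
    rw [growth_succ]
    exact le_mul_of_one_le_right (growth_pos hf d).le (by linarith [half_div_nonneg hf d])

lemma decay_anti (hf : ∀ k, 1 ≤ f k) : Antitone (decay f) :=
  antitone_nat_of_succ_le fun d => by
    rw [decay_succ]
    exact mul_le_of_le_one_right (decay_pos hf d).le (by linarith [half_div_nonneg hf d])

lemma decay_le_one (hf : ∀ k, 1 ≤ f k) (d : ℕ) : decay f d ≤ 1 := by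
  simpa [decay] using decay_anti hf (Nat.zero_le d)

/-- The squares `1 / f l ^ 2` being summable, `growth` and `decay` are inverse to each other up to
a constant. -/
lemma exists_le_growth_mul_decay (hf : ∀ k, 1 ≤ f k) (hsum : Summable fun l => 1 / f l ^ 2) :
    ∃ r, 0 < r ∧ ∀ d, r ≤ growth f d * decay f d := by
  refine ⟨Real.exp (-(1 / 2 * ∑' l, 1 / f l ^ 2)), Real.exp_pos _, fun d => ?_⟩
  rw [growth, decay, ← Finset.prod_mul_distrib]
  have h1 : ∏ l ∈ Finset.range d, Real.exp (-(1 / 2 * (1 / f l ^ 2))) ≤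
      ∏ l ∈ Finset.range d, ((1 + 1 / 2 / f l) * (1 - 1 / 2 / f l)) := by
    refine Finset.prod_le_prod (fun _ _ => (Real.exp_pos _).le) fun l _ => ?_
    have hl : 0 < f l := zero_lt_one.trans_le (hf l)
    set x := 1 / f l ^ 2
    have hx0 : 0 ≤ x := by positivity
    have hx1 : x ≤ 1 := div_le_one_of_le₀ (one_le_pow₀ (hf l)) (by positivity)
    have hx : (1 + 1 / 2 / f l) * (1 - 1 / 2 / f l) = 1 - x / 4 := by
      simp only [x]; field_simp; ring
    rw [hx, Real.exp_neg, inv_le_comm₀ (Real.exp_pos _) (by linarith)]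
    refine le_trans ?_ (Real.add_one_le_exp _)
    rw [inv_le_iff_one_le_mul₀ (by linarith)]
    nlinarith
  refine le_trans ?_ h1
  rw [← Real.exp_sum, Finset.sum_neg_distrib, ← Finset.mul_sum]
  refine Real.exp_le_exp.2 (neg_le_neg ?_)
  exact mul_le_mul_of_nonneg_left (hsum.sum_le_tsum _ fun _ _ => by positivity) (by norm_num)

lemma integral_decay_succ_le [IsProbabilityMeasure μ] (hT : IsAttachmentProcess μ f m T)
    (hf : ∀ k, 1 ≤ f k) (hm : ∀ n, 1 ≤ n → 1 ≤ m n) {k i : ℕ} (hi : edgeCount m i ≤ k) {c : ℝ}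
    (hc : ∀ ω, totalWeight f m T k ω ≤ c) :
    ∫ ω, decay f (degreeProcess m T i (k + 1) ω) ∂μ ≤
      Real.exp (-(1 / 2 * (1 / c))) * ∫ ω, decay f (degreeProcess m T i k ω) ∂μ := by
  have hf0 : ∀ k, 0 < f k := fun k => zero_lt_one.trans_le (hf k)
  have hint : ∀ G : ℕ → ℝ, ∀ k, Integrable (fun ω => G (degreeProcess m T i k ω)) μ := fun G k =>
    integrable_degreeProcess hT.measurable m (fun a _ => G a) i i k
  set Δ : ℕ → ℝ := fun a => decay f (a + 1) - decay f a
  have hTi : MeasurableSet {ω | T (k + 1) ω = i} := hT.measurable _ (measurableSet_singleton i)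
  have hcond := condExp_head_mul hT hf0 hm hi (fun a _ => Δ a) i
  have hΔint : Integrable (fun ω => Δ (degreeProcess m T i k ω) *
      {ω | T (k + 1) ω = i}.indicator (fun _ => (1 : ℝ)) ω) μ := by
    refine ((hint Δ k).indicator hTi).congr (ae_of_all _ fun ω => ?_)
    by_cases h : T (k + 1) ω = i <;> simp [Set.indicator, h]
  have hgain : ∫ ω, Δ (degreeProcess m T i k ω) *
      {ω | T (k + 1) ω = i}.indicator (fun _ => (1 : ℝ)) ω ∂μ =
      ∫ ω, Δ (degreeProcess m T i k ω) *
        (f (degreeProcess m T i k ω) / totalWeight f m T k ω) ∂μ := by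
    rw [← integral_congr_ae hcond, integral_condExp ((historyFiltration T hT.measurable).le k)]
  have hstep : ∀ ω, decay f (degreeProcess m T i (k + 1) ω) = decay f (degreeProcess m T i k ω) +
      Δ (degreeProcess m T i k ω) * {ω | T (k + 1) ω = i}.indicator (fun _ => (1 : ℝ)) ω := by
    intro ω
    rw [degreeProcess_succ hm hi]
    by_cases h : T (k + 1) ω = i <;> simp [Set.indicator, h, Δ]
  simp only [hstep]
  rw [integral_add (hint _ k) hΔint, hgain, ← integral_add (hint _ k)
    (integrable_condExp.congr hcond), ← integral_const_mul]
  refine integral_mono ((hint _ k).add (integrable_condExp.congr hcond))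
    ((hint _ k).const_mul _) fun ω => ?_
  set a := degreeProcess m T i k ω
  have hS : 0 < totalWeight f m T k ω := totalWeight_pos hf0 hm k ω
  have h1 : decay f a + Δ a * (f a / totalWeight f m T k ω) =
      (1 - 1 / 2 * (1 / totalWeight f m T k ω)) * decay f a := by
    have := (hf0 a).ne'
    simp only [Δ, decay_succ]
    field_simp
    ring
  change decay f a + Δ a * (f a / totalWeight f m T k ω) ≤ _
  rw [h1]
  refine mul_le_mul_of_nonneg_right ?_ (decay_pos hf a).le
  have h2 : 1 / c ≤ 1 / totalWeight f m T k ω := one_div_le_one_div_of_le hS (hc ω)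
  have h3 := Real.add_one_le_exp (-(1 / 2 * (1 / c)))
  linarith

lemma integral_decay_le [IsProbabilityMeasure μ] (hT : IsAttachmentProcess μ f m T)
    (hf : ∀ k, 1 ≤ f k) (hm : ∀ n, 1 ≤ n → 1 ≤ m n) {w : ℕ → ℝ}
    (hw : ∀ k ω, totalWeight f m T k ω ≤ w k) {k i : ℕ} (hi : edgeCount m i ≤ k) :
    ∫ ω, decay f (degreeProcess m T i k ω) ∂μ ≤
      Real.exp (-(1 / 2 * ∑ l ∈ Finset.Ico (edgeCount m i) k, 1 / w l)) := by
  induction k, hi using Nat.le_induction with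
  | base =>
    have := integral_mono
      (integrable_degreeProcess hT.measurable m (fun a _ => decay f a) i i (edgeCount m i))
      (integrable_const (1 : ℝ) (μ := μ)) fun ω => decay_le_one hf _
    simpa using this
  | succ k hk ih =>
    refine (integral_decay_succ_le hT hf hm hk (hw k)).trans ?_
    rw [Finset.sum_Ico_succ_top hk, mul_add, neg_add, Real.exp_add,
      mul_comm (Real.exp (-(1 / 2 * ∑ l ∈ Finset.Ico (edgeCount m i) k, 1 / w l)))]
    exact mul_le_mul_of_nonneg_left ih (Real.exp_pos _).le

lemma measure_decay_ge [IsProbabilityMeasure μ] (hT : IsAttachmentProcess μ f m T)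
    (hf : ∀ k, 1 ≤ f k) (i k : ℕ) {c : ℝ} (hc : 0 < c) :
    μ {ω | c ≤ decay f (degreeProcess m T i k ω)} ≤
      ENNReal.ofReal ((∫ ω, decay f (degreeProcess m T i k ω) ∂μ) / c) := by
  have h1 := mul_meas_ge_le_integral_of_nonneg
    (ae_of_all μ fun ω => (decay_pos hf (degreeProcess m T i k ω)).le)
    (integrable_degreeProcess hT.measurable m (fun a _ => decay f a) i i k) c
  rw [← ofReal_measureReal]
  exact ENNReal.ofReal_le_ofReal ((le_div_iff₀' hc).2 h1)

lemma ae_tendsto_degree [IsProbabilityMeasure μ] (hT : IsAttachmentProcess μ f m T)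
    (hf : ∀ k, 1 ≤ f k) (hm : ∀ n, 1 ≤ n → 1 ≤ m n) {w : ℕ → ℝ}
    (hw : ∀ k ω, totalWeight f m T k ω ≤ w k)
    (hdiv : Tendsto (fun k => ∑ l ∈ Finset.range k, 1 / w l) atTop atTop) (i : ℕ) :
    ∀ᵐ ω ∂μ, Tendsto (fun k => degreeProcess m T i k ω) atTop atTop := by
  have hlim : Tendsto (fun k => ∫ ω, decay f (degreeProcess m T i k ω) ∂μ) atTop (𝓝 0) := by
    have h1 : Tendsto (fun k => Real.exp (-(1 / 2 * (∑ l ∈ Finset.range k, 1 / w l -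
        ∑ l ∈ Finset.range (edgeCount m i), 1 / w l)))) atTop (𝓝 0) :=
      Real.tendsto_exp_neg_atTop_nhds_zero.comp
        ((tendsto_atTop_add_const_right _ _ hdiv).const_mul_atTop (by norm_num))
    refine tendsto_of_tendsto_of_tendsto_of_le_of_le' tendsto_const_nhds h1
      (Eventually.of_forall fun k => integral_nonneg fun ω => (decay_pos hf _).le) ?_
    filter_upwards [eventually_ge_atTop (edgeCount m i)] with k hk
    rw [← Finset.sum_Ico_eq_sub _ hk]
    exact integral_decay_le hT hf hm hw hk
  have hD : ∀ D, ∀ᵐ ω ∂μ, ∃ k, D < degreeProcess m T i k ω := by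
    intro D
    have h1 : ∀ k, μ {ω | ¬ ∃ k, D < degreeProcess m T i k ω} ≤
        ENNReal.ofReal ((∫ ω, decay f (degreeProcess m T i k ω) ∂μ) / decay f D) := by
      refine fun k => le_trans (measure_mono fun ω hω => ?_)
        (measure_decay_ge hT hf i k (decay_pos hf D))
      exact decay_anti hf (not_lt.1 (not_exists.1 hω k))
    have h2 := ENNReal.tendsto_ofReal (hlim.div_const (decay f D))
    rw [zero_div, ENNReal.ofReal_zero] at h2
    exact le_antisymm (ge_of_tendsto' h2 h1) bot_le
  filter_upwards [ae_all_iff.2 hD] with ω hω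
  refine tendsto_atTop_atTop_of_monotone (degreeProcess_mono m T i ω) fun D => ?_
  obtain ⟨k, hk⟩ := hω D
  exact ⟨k, hk.le⟩

/-! ### Late vertices stay behind the first one -/

lemma growth_mul_decay_harmonic (hf : ∀ k, 1 ≤ f k) (a b : ℕ) :
    f a * (growth f (a + 1) * decay f b - growth f a * decay f b) +
      f b * (growth f a * decay f (b + 1) - growth f a * decay f b) = 0 := by
  have ha := (zero_lt_one.trans_le (hf a)).ne'
  have hb := (zero_lt_one.trans_le (hf b)).ne'
  rw [growth_succ, decay_succ]
  field_simp
  ring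

/-- Ville's inequality for nonnegative martingales. -/
lemma measure_exists_ge_le [IsProbabilityMeasure μ] {ℱ : Filtration ℕ mΩ} {M : ℕ → Ω → ℝ}
    (hM : Martingale M ℱ μ) (hM0 : 0 ≤ M) {r : ℝ} (hr : 0 < r) :
    μ {ω | ∃ n, r ≤ M n ω} ≤ ENNReal.ofReal ((∫ ω, M 0 ω ∂μ) / r) := by
  set S : ℕ → Set Ω := fun N => {ω | ∃ n ≤ N, r ≤ M n ω}
  have hS : {ω | ∃ n, r ≤ M n ω} = ⋃ N, S N := by
    ext ω
    simp only [S, Set.mem_ofPred_eq, Set.mem_iUnion]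
    exact ⟨fun ⟨n, hn⟩ => ⟨n, n, le_rfl, hn⟩, fun ⟨_, n, _, hn⟩ => ⟨n, hn⟩⟩
  have hmono : Monotone S := fun a b hab ω ⟨n, hn, h⟩ => ⟨n, hn.trans hab, h⟩
  rw [hS, hmono.measure_iUnion]
  refine iSup_le fun N => ?_
  have h1 := maximal_ineq hM.submartingale hM0 (ε := r.toNNReal) N
  have hSN : {ω | (r.toNNReal : ℝ) ≤ (Finset.range (N + 1)).sup' Finset.nonempty_range_add_one
      fun k => M k ω} = S N := by
    ext ω
    simp only [S, Set.mem_ofPred_eq, Finset.le_sup'_iff, Finset.mem_range, Nat.lt_succ_iff,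
      Real.coe_toNNReal r hr.le]
  rw [hSN] at h1
  have h2 : ∫ ω in S N, M N ω ∂μ ≤ ∫ ω, M 0 ω ∂μ := by
    refine (setIntegral_le_integral (hM.integrable N) (ae_of_all _ (hM0 N))).trans_eq ?_
    have := hM.setIntegral_eq (Nat.zero_le N) MeasurableSet.univ
    simpa using this.symm
  rw [ENNReal.ofReal_div_of_pos hr, ENNReal.le_div_iff_mul_le
    (Or.inl (by simpa using hr)) (Or.inl ENNReal.ofReal_ne_top), mul_comm]
  exact h1.trans (ENNReal.ofReal_le_ofReal h2)

/-- If `v_{n+1}` catches up with `v_0` after the attachment of its own edges, then the martingale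
`growth (degree v_{n+1}) * decay (degree v_0)`, which starts small, reaches `r`. If it does so
before, then the degree of `v_0` was at most `m (n + 1)` at time `edgeCount m n`. -/
lemma measure_catch_up_le [IsProbabilityMeasure μ] (hT : IsAttachmentProcess μ f m T)
    (hf : ∀ k, 1 ≤ f k) (hm : ∀ n, 1 ≤ n → 1 ≤ m n) {r : ℝ} (hr : 0 < r)
    (hrle : ∀ d, r ≤ growth f d * decay f d) (n : ℕ) :
    μ {ω | ∃ k, edgeCount m n ≤ k ∧ degreeProcess m T 0 k ω ≤ degreeProcess m T (n + 1) k ω} ≤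
      2 * ENNReal.ofReal (growth f (m (n + 1)) *
        (∫ ω, decay f (degreeProcess m T 0 (edgeCount m n) ω) ∂μ) / r) := by
  have hf0 : ∀ k, 0 < f k := fun k => zero_lt_one.trans_le (hf k)
  set g := growth f (m (n + 1))
  have hg : 0 < g := growth_pos hf _
  have hsn : edgeCount m (n + 1) = edgeCount m n + m (n + 1) := edgeCount_succ m n
  set M : ℕ → Ω → ℝ := fun l ω => growth f (degreeProcess m T (n + 1) (edgeCount m (n + 1) + l) ω) *
    decay f (degreeProcess m T 0 (edgeCount m (n + 1) + l) ω)
  have hM : Martingale M (restartedFiltration T hT.measurable (edgeCount m (n + 1))) μ :=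
    martingale_of_harmonic (G := fun a b => growth f a * decay f b) hT hf0 hm
      (growth_mul_decay_harmonic hf) (Nat.succ_ne_zero n) le_rfl
      (edgeCount_mono m (Nat.zero_le _))
  have hM0 : 0 ≤ M := fun l ω => (mul_pos (growth_pos hf _) (decay_pos hf _)).le
  set E := ∫ ω, decay f (degreeProcess m T 0 (edgeCount m n) ω) ∂μ
  have hlt := ae_head_lt hT hf0 hm
  have hstart : ∫ ω, M 0 ω ∂μ ≤ g * E := by
    rw [← integral_const_mul]
    refine integral_mono_ae (hM.integrable 0) ((integrable_degreeProcess hT.measurable m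
      (fun a _ => decay f a) 0 0 _).const_mul _) ?_
    filter_upwards [hlt] with ω hω
    refine mul_le_mul (growth_mono hf ?_) (decay_anti hf ?_) (decay_pos hf _).le hg.le
    · refine (degree_le_of_le hm hω le_rfl).trans ?_
      omega
    · exact degreeProcess_mono m T 0 ω (by omega)
  have hA : μ {ω | r / g ≤ decay f (degreeProcess m T 0 (edgeCount m n) ω)} ≤
      ENNReal.ofReal (g * E / r) := by
    refine (measure_decay_ge hT hf 0 (edgeCount m n) (div_pos hr hg)).trans_eq
      (congrArg ENNReal.ofReal (?_ : E / (r / g) = g * E / r))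
    field_simp
  have hB : μ {ω | ∃ l, r ≤ M l ω} ≤ ENNReal.ofReal (g * E / r) :=
    (measure_exists_ge_le hM hM0 hr).trans
      (ENNReal.ofReal_le_ofReal (div_le_div_of_nonneg_right hstart hr.le))
  rw [two_mul]
  refine le_trans (measure_mono_ae ?_) ((measure_union_le _ _).trans (add_le_add hA hB))
  filter_upwards [hlt] with ω hω
  rintro ⟨k, hk, hcatch⟩
  rcases le_total k (edgeCount m (n + 1)) with hk1 | hk1
  · left
    have h1 : degreeProcess m T (n + 1) k ω ≤ m (n + 1) :=
      (degree_le_of_le hm hω hk1).trans (by omega)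
    have h2 : degreeProcess m T 0 (edgeCount m n) ω ≤ m (n + 1) :=
      ((degreeProcess_mono m T 0 ω hk).trans hcatch).trans h1
    change r / g ≤ _
    rw [div_le_iff₀' hg]
    exact (hrle _).trans (mul_le_mul_of_nonneg_left (decay_anti hf h2) hg.le)
  · right
    obtain ⟨l, rfl⟩ := Nat.exists_eq_add_of_le hk1
    exact ⟨l, (hrle _).trans (mul_le_mul_of_nonneg_left (decay_anti hf hcatch)
      (growth_pos hf _).le)⟩

/-- A criterion for a persistent hub in terms of deterministic bounds `w` for the normalisers. -/
theorem ae_hasPersistentHub [IsProbabilityMeasure μ] (hT : IsAttachmentProcess μ f m T)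
    (hf : ∀ k, 1 ≤ f k) (hm : ∀ n, 1 ≤ n → 1 ≤ m n) (hsum : Summable fun l => 1 / f l ^ 2)
    {w : ℕ → ℝ} (hw : ∀ k ω, totalWeight f m T k ω ≤ w k)
    (hdiv : Tendsto (fun k => ∑ l ∈ Finset.range k, 1 / w l) atTop atTop)
    (hlate : Summable fun n => growth f (m (n + 1)) *
      Real.exp (-(1 / 2 * ∑ l ∈ Finset.range (edgeCount m n), 1 / w l))) :
    ∀ᵐ ω ∂μ, HasPersistentHub (edgeGraph m fun j => T j ω) := by
  have hf0 : ∀ k, 0 < f k := fun k => zero_lt_one.trans_le (hf k)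
  obtain ⟨r, hr, hrle⟩ := exists_le_growth_mul_decay hf hsum
  set A : ℕ → Set Ω := fun n =>
    {ω | ∃ k, edgeCount m n ≤ k ∧ degreeProcess m T 0 k ω ≤ degreeProcess m T (n + 1) k ω}
  have hA : ∑' n, μ (A n) ≠ ⊤ := by
    have h1 : ∀ n, μ (A n) ≤ 2 * ENNReal.ofReal (growth f (m (n + 1)) *
        Real.exp (-(1 / 2 * ∑ l ∈ Finset.range (edgeCount m n), 1 / w l)) / r) := by
      intro n
      refine (measure_catch_up_le hT hf hm hr hrle n).trans
        (mul_le_mul' le_rfl (ENNReal.ofReal_le_ofReal (div_le_div_of_nonneg_right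
          (mul_le_mul_of_nonneg_left ?_ (growth_pos hf _).le) hr.le)))
      have h2 := integral_decay_le hT hf hm hw (edgeCount_mono m (Nat.zero_le n))
      rwa [show edgeCount m 0 = 0 from rfl, ← Finset.range_eq_Ico] at h2
    refine ne_top_of_le_ne_top ?_ (ENNReal.tsum_le_tsum h1)
    rw [ENNReal.tsum_mul_left]
    exact ENNReal.mul_ne_top (by norm_num) (hlate.div_const r).tsum_ofReal_ne_top
  have hties : ∀ᵐ ω ∂μ, ∀ i j, i ≠ j →
      ∃ K, ∀ k, K ≤ k → degreeProcess m T i k ω ≠ degreeProcess m T j k ω := by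
    refine ae_all_iff.2 fun i => ae_all_iff.2 fun j => ?_
    by_cases hij : i = j
    · exact ae_of_all _ fun ω h => absurd hij h
    · filter_upwards [ae_eventually_degree_ne hT hf0 hm hsum hij
        (ae_tendsto_degree hT hf hm hw hdiv i)] with ω h _ using h
  filter_upwards [ae_eventually_notMem hA, hties] with ω h1 h2
  refine hasPersistentHub_of_no_ties hm ?_ h2
  obtain ⟨n₁, hn₁⟩ := eventually_atTop.1 h1
  exact ⟨n₁, fun n hn k hk => not_le.1 fun hle => hn₁ n hn ⟨k, hk, hle⟩⟩

end RandomHeads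

/-! ### Bounds for the normalisers -/

/-- A bound for the normaliser at time `k`, namely `6 n (m n) ^ α` where `v_n` is the source of the
edge `k + 1`. -/
noncomputable def weightBound (α : ℝ) (m : ℕ → ℕ) (k : ℕ) : ℝ :=
  6 * source m (k + 1) * (m (source m (k + 1)) : ℝ) ^ α

lemma rpow_le_mul_one_add_div {α x c : ℝ} (hα : 0 ≤ α) (hα' : α ≤ 1) (hx : 0 ≤ x) (hc : 0 < c) :
    x ^ α ≤ c ^ α * (1 + x / c) := by
  rcases le_total x c with h | h
  · have h1 : x ^ α ≤ c ^ α := Real.rpow_le_rpow hx h hα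
    have h2 : 0 ≤ x / c := by positivity
    nlinarith [Real.rpow_nonneg hc.le α]
  · have h1 : (x / c) ^ α ≤ x / c :=
      (Real.rpow_le_rpow_of_exponent_le ((one_le_div hc).2 h) hα').trans_eq (Real.rpow_one _)
    rw [Real.div_rpow hx hc.le, div_le_iff₀ (by positivity)] at h1
    nlinarith [Real.rpow_nonneg hc.le α]

/-- As `f` is sublinear and the mean degree is at most `2 m n`, the normaliser is at most of order
`n (m n) ^ α`. -/
lemma totalWeight_le_weightBound {Ω : Type*} {α : ℝ} (hα : 0 ≤ α) (hα' : α ≤ 1) {f : ℕ → ℝ}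
    (hf : ∀ k : ℕ, f k = ((k : ℝ) + 1) ^ α) {m : ℕ → ℕ} (hm : ∀ n, 1 ≤ n → 1 ≤ m n)
    (hmono : ∀ i j, 1 ≤ i → i ≤ j → m i ≤ m j) (T : ℕ → Ω → ℕ) (k : ℕ) (ω : Ω) :
    totalWeight f m T k ω ≤ weightBound α m k := by
  set n := source m (k + 1)
  have hn : 1 ≤ n := (lt_source_succ_iff hm).2 (by simp [edgeCount])
  have hmn : (1 : ℝ) ≤ m n := by exact_mod_cast hm n hn
  have hn' : (1 : ℝ) ≤ n := by exact_mod_cast hn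
  have hk : k + 1 ≤ n * m n := by
    refine ((source_le_iff hm).1 le_rfl).trans ?_
    have := Finset.sum_le_card_nsmul (Finset.Icc 1 n) m (m n) fun i hi =>
      hmono i n (Finset.mem_Icc.1 hi).1 (Finset.mem_Icc.1 hi).2
    simpa [edgeCount] using this
  have hk' : (k : ℝ) ≤ n * m n := by
    have : ((k + 1 : ℕ) : ℝ) ≤ ((n * m n : ℕ) : ℝ) := Nat.cast_le.2 hk
    push_cast at this
    linarith
  set c : ℝ := 3 * m n
  have hc : 0 < c := by positivity
  have h1 : totalWeight f m T k ω ≤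
      ∑ v ∈ Finset.range n, c ^ α * (1 + ((degreeProcess m T v k ω : ℝ) + 1) / c) :=
    Finset.sum_le_sum fun v _ => by
      rw [hf]
      exact rpow_le_mul_one_add_div hα hα' (by positivity) hc
  have hsum : (∑ v ∈ Finset.range n, (degreeProcess m T v k ω : ℝ)) ≤ 2 * k := by
    exact_mod_cast sum_degree_le m (fun j => T j ω) k n
  have h2 : ∑ v ∈ Finset.range n, c ^ α * (1 + ((degreeProcess m T v k ω : ℝ) + 1) / c) ≤
      c ^ α * (2 * n) := by
    rw [← Finset.mul_sum, Finset.sum_add_distrib, ← Finset.sum_div, Finset.sum_add_distrib]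
    refine mul_le_mul_of_nonneg_left ?_ (by positivity)
    simp only [Finset.sum_const, Finset.card_range, nsmul_eq_mul, mul_one]
    have : (∑ v ∈ Finset.range n, (degreeProcess m T v k ω : ℝ) + n) / c ≤ n := by
      rw [div_le_iff₀ hc]
      nlinarith
    linarith
  have h3 : c ^ α ≤ 3 * (m n : ℝ) ^ α := by
    rw [Real.mul_rpow (by norm_num) (by positivity)]
    refine mul_le_mul_of_nonneg_right ?_ (by positivity)
    exact (Real.rpow_le_rpow_of_exponent_le (by norm_num) hα').trans_eq (Real.rpow_one 3)
  refine (h1.trans h2).trans ?_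
  change _ ≤ 6 * (n : ℝ) * (m n : ℝ) ^ α
  nlinarith

lemma source_eq {m : ℕ → ℕ} (hm : ∀ n, 1 ≤ n → 1 ≤ m n) {n k : ℕ} (h1 : edgeCount m n ≤ k)
    (h2 : k < edgeCount m (n + 1)) : source m (k + 1) = n + 1 :=
  le_antisymm ((source_le_iff hm).2 h2) ((lt_source_succ_iff hm).2 h1)

lemma sum_inv_weightBound_succ (α : ℝ) {m : ℕ → ℕ} (hm : ∀ n, 1 ≤ n → 1 ≤ m n) (n : ℕ) :
    ∑ l ∈ Finset.range (edgeCount m (n + 1)), 1 / weightBound α m l =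
      ∑ l ∈ Finset.range (edgeCount m n), 1 / weightBound α m l +
        (m (n + 1) : ℝ) ^ (1 - α) / (6 * (n + 1)) := by
  rw [← Finset.sum_range_add_sum_Ico _ (edgeCount_mono m (Nat.le_succ n))]
  congr 1
  have h1 : ∀ l ∈ Finset.Ico (edgeCount m n) (edgeCount m (n + 1)),
      1 / weightBound α m l = 1 / (6 * ((n : ℝ) + 1) * (m (n + 1) : ℝ) ^ α) := by
    intro l hl
    rw [Finset.mem_Ico] at hl
    rw [weightBound, source_eq hm hl.1 hl.2]
    push_cast
    rfl
  have hpos : (0 : ℝ) < m (n + 1) := by exact_mod_cast hm (n + 1) (by omega)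
  have hcard : edgeCount m (n + 1) - edgeCount m n = m (n + 1) := by
    rw [edgeCount_succ]
    omega
  rw [Finset.sum_congr rfl h1, Finset.sum_const, Nat.card_Ico, hcard, nsmul_eq_mul,
    Real.rpow_sub hpos, Real.rpow_one]
  field_simp

/-- Convexity of `x ^ (1 + δ)`: the tangent at `x` lies below the graph. -/
lemma rpow_one_add_sub_le {δ x y : ℝ} (hδ : 0 ≤ δ) (hy : 0 ≤ y) (hx : 0 < x) :
    x ^ (1 + δ) - y ^ (1 + δ) ≤ (1 + δ) * x ^ δ * (x - y) := by
  have h1 := one_add_mul_self_le_rpow_one_add (s := y / x - 1) (by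
    have : 0 ≤ y / x := by positivity
    linarith) (p := 1 + δ) (by linarith)
  rw [add_sub_cancel, Real.div_rpow hy hx.le, le_div_iff₀ (by positivity)] at h1
  have h2 : x ^ (1 + δ) = x * x ^ δ := by rw [Real.rpow_add hx, Real.rpow_one]
  have h3 : (1 + (1 + δ) * (y / x - 1)) * x ^ (1 + δ) =
      x ^ (1 + δ) - (1 + δ) * x ^ δ * (x - y) := by
    rw [h2]
    field_simp
    ring
  linarith

/-- The sum of `m_j ^ (1 - α) / j` over `j ≤ n` has order at least `(log n) ^ (1 + ν (1 - α))`. -/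
lemma le_sum_inv_weightBound {α ν : ℝ} (hα' : α < 1) (hν : 0 < ν) {m : ℕ → ℕ}
    (hm : ∀ n, 1 ≤ n → 1 ≤ m n) (hlow : ∀ n : ℕ, 1 ≤ n → Real.log n ^ ν ≤ m n) {n : ℕ}
    (hn : 1 ≤ n) :
    1 / (6 * (1 + ν * (1 - α)) * 2 ^ (ν * (1 - α))) *
        (Real.log (n + 1) ^ (1 + ν * (1 - α)) - Real.log 2 ^ (1 + ν * (1 - α))) ≤
      ∑ l ∈ Finset.range (edgeCount m n), 1 / weightBound α m l := by
  set δ := ν * (1 - α)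
  have hδ : 0 < δ := mul_pos hν (by linarith)
  induction n, hn using Nat.le_induction with
  | base =>
    norm_num
    exact Finset.sum_nonneg fun l _ => by
      rw [weightBound]
      positivity
  | succ n hn ih =>
    rw [sum_inv_weightBound_succ α hm]
    have hn' : (1 : ℝ) ≤ n := by exact_mod_cast hn
    push_cast
    set y := Real.log ((n : ℝ) + 1)
    set x := Real.log ((n : ℝ) + 1 + 1)
    have hy : 0 < y := Real.log_pos (by linarith)
    have hx : 0 < x := Real.log_pos (by linarith)
    have hxy : x - y ≤ 1 / ((n : ℝ) + 1) := by
      have h1 := Real.log_le_sub_one_of_pos (x := ((n : ℝ) + 1 + 1) / (n + 1)) (by positivity)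
      rw [Real.log_div (by positivity) (by positivity)] at h1
      refine h1.trans_eq ?_
      field_simp
      ring
    have hx2 : x ≤ 2 * y := by
      have h1 : x ≤ Real.log (((n : ℝ) + 1) ^ 2) :=
        Real.log_le_log (by positivity) (by nlinarith)
      rwa [Real.log_pow] at h1
    have hxδ : x ^ δ ≤ 2 ^ δ * y ^ δ := by
      rw [← Real.mul_rpow (by norm_num) hy.le]
      exact Real.rpow_le_rpow hx.le hx2 hδ.le
    have hmδ : y ^ δ ≤ (m (n + 1) : ℝ) ^ (1 - α) := by
      have h1 := hlow (n + 1) (by omega)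
      push_cast at h1
      rw [show y ^ δ = (y ^ ν) ^ (1 - α) from Real.rpow_mul hy.le _ _]
      exact Real.rpow_le_rpow (by positivity) h1 (by linarith)
    have h1 : x ^ (1 + δ) - y ^ (1 + δ) ≤
        (1 + δ) * (2 ^ δ * (m (n + 1) : ℝ) ^ (1 - α)) * (1 / ((n : ℝ) + 1)) := by
      refine (rpow_one_add_sub_le hδ.le hy.le hx).trans ?_
      have h2 : x ^ δ ≤ 2 ^ δ * (m (n + 1) : ℝ) ^ (1 - α) :=
        hxδ.trans (mul_le_mul_of_nonneg_left hmδ (by positivity))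
      have h3 : (1 + δ) * x ^ δ * (x - y) ≤ (1 + δ) * x ^ δ * (1 / ((n : ℝ) + 1)) :=
        mul_le_mul_of_nonneg_left hxy (by positivity)
      refine h3.trans (mul_le_mul_of_nonneg_right ?_ (by positivity))
      exact mul_le_mul_of_nonneg_left h2 (by linarith)
    have h4 := mul_le_mul_of_nonneg_left h1
      (show 0 ≤ 1 / (6 * (1 + δ) * 2 ^ δ) by positivity)
    have h5 : 1 / (6 * (1 + δ) * 2 ^ δ) *
        ((1 + δ) * (2 ^ δ * (m (n + 1) : ℝ) ^ (1 - α)) * (1 / ((n : ℝ) + 1))) =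
        (m (n + 1) : ℝ) ^ (1 - α) / (6 * (n + 1)) := by
      field_simp
    linarith

lemma sum_one_div_rpow_le {α : ℝ} (hα : 0 ≤ α) (hα' : α < 1) (M : ℕ) :
    ∑ l ∈ Finset.range M, 1 / ((l : ℝ) + 1) ^ α ≤ (M : ℝ) ^ (1 - α) / (1 - α) := by
  have h1α : 0 < 1 - α := by linarith
  induction M with
  | zero => simp [h1α.ne']
  | succ M ih =>
    rw [Finset.sum_range_succ]
    have hM : (0 : ℝ) < (M : ℝ) + 1 := by positivity
    -- Concavity of `x ^ (1 - α)`: the tangent at `M + 1` lies above the graph.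
    have h1 := rpow_one_add_le_one_add_mul_self (s := -1 / ((M : ℝ) + 1)) (by
      rw [le_div_iff₀ hM]; linarith [Nat.cast_nonneg (α := ℝ) M]) h1α.le (p := 1 - α) (by linarith)
    have h2 : 1 + -1 / ((M : ℝ) + 1) = M / (M + 1) := by field_simp; ring
    rw [h2, Real.div_rpow (by positivity) hM.le, div_le_iff₀ (by positivity)] at h1
    have h3 : ((M : ℝ) + 1) ^ (1 - α) = (M + 1) * (1 / ((M : ℝ) + 1) ^ α) := by
      rw [Real.rpow_sub hM, Real.rpow_one]; field_simp
    have h4 : (1 + (1 - α) * (-1 / ((M : ℝ) + 1))) * ((M : ℝ) + 1) ^ (1 - α) =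
        ((M : ℝ) + 1) ^ (1 - α) - (1 - α) * (1 / ((M : ℝ) + 1) ^ α) := by
      rw [h3]; field_simp; ring
    rw [le_div_iff₀ h1α] at ih ⊢
    push_cast
    linarith

lemma growth_le {α : ℝ} (hα : 0 ≤ α) (hα' : α < 1) {f : ℕ → ℝ}
    (hf : ∀ k : ℕ, f k = ((k : ℝ) + 1) ^ α) (M : ℕ) :
    growth f M ≤ Real.exp (1 / 2 * ((M : ℝ) ^ (1 - α) / (1 - α))) := by
  have h1 : growth f M ≤ ∏ l ∈ Finset.range M, Real.exp (1 / 2 * (1 / ((l : ℝ) + 1) ^ α)) := by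
    refine Finset.prod_le_prod (fun l _ => ?_) fun l _ => ?_
    · rw [hf]; positivity
    · have := Real.add_one_le_exp (1 / 2 * (1 / ((l : ℝ) + 1) ^ α))
      rw [hf, div_eq_mul_one_div (1 / 2 : ℝ)]
      linarith
  refine h1.trans ?_
  rw [← Real.exp_sum, ← Finset.mul_sum]
  exact Real.exp_le_exp.2 (mul_le_mul_of_nonneg_left (sum_one_div_rpow_le hα hα' M) (by norm_num))

lemma summable_one_div_sq {α : ℝ} (hα : 1 / 2 < α) {f : ℕ → ℝ}
    (hf : ∀ k : ℕ, f k = ((k : ℝ) + 1) ^ α) : Summable fun l => 1 / f l ^ 2 := by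
  have h1 := (summable_nat_add_iff 1).2 (Real.summable_one_div_nat_rpow.2
    (show 1 < α * 2 by linarith))
  refine h1.congr fun l => ?_
  rw [hf, Real.rpow_mul (by positivity)]
  push_cast
  norm_num

/-- The initial value of the catch-up martingale of `v_{n+1}` decays faster than any power of `n`:
`(log n) ^ (1 + ν (1 - α))` beats both `Φ₁ (m n)`, of order `(log n) ^ (ν (1 - α))`, and `log n`. -/
lemma summable_growth_mul_exp {α ν : ℝ} (hα : 0 ≤ α) (hα' : α < 1) (hν : 0 < ν) {f : ℕ → ℝ}
    (hf : ∀ k : ℕ, f k = ((k : ℝ) + 1) ^ α) {m : ℕ → ℕ}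
    (hm : ∀ n, 1 ≤ n → 1 ≤ m n) (hlow : ∀ n : ℕ, 1 ≤ n → Real.log n ^ ν ≤ m n)
    (hup : ∀ n : ℕ, 1 ≤ n → (m n : ℝ) ≤ 1 + Real.log n ^ ν) :
    Summable fun n => growth f (m (n + 1)) * Real.exp (-(1 / 2 *
      ∑ l ∈ Finset.range (edgeCount m n), 1 / weightBound α m l)) := by
  have h1α : 0 < 1 - α := by linarith
  set δ := ν * (1 - α) with hδdef
  have hδ : 0 < δ := mul_pos hν h1α
  set c := 1 / (6 * (1 + δ) * 2 ^ δ)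
  have hc : 0 < c := by positivity
  set K := c * Real.log 2 ^ (1 + δ) + 1 / (1 - α)
  have hlog : Tendsto (fun n : ℕ => Real.log ((n : ℝ) + 1)) atTop atTop :=
    Real.tendsto_log_atTop.comp
      (tendsto_atTop_add_const_right _ _ tendsto_natCast_atTop_atTop)
  have hp := (summable_nat_add_iff 1).2 (Real.summable_one_div_nat_rpow.2
    (show (1 : ℝ) < 2 by norm_num))
  refine Summable.of_norm_bounded_eventually_nat hp ?_
  filter_upwards [hlog.eventually_ge_atTop 1, hlog.eventually_ge_atTop K,
    hlog.eventually_ge_atTop (2 / (c * (1 - α))),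
    ((tendsto_rpow_atTop hδ).comp hlog).eventually_ge_atTop (10 / c),
    eventually_ge_atTop 1] with n hx1 hxK hxc hxδ hn
  change 10 / c ≤ Real.log ((n : ℝ) + 1) ^ δ at hxδ
  have hlower := le_sum_inv_weightBound hα' hν hm hlow hn
  have hgrow := growth_le hα hα' hf (m (n + 1))
  have hupn := hup (n + 1) (by omega)
  push_cast at hupn
  set x := Real.log ((n : ℝ) + 1) with hx
  have hx0 : 0 < x := by linarith
  have hmx : (m (n + 1) : ℝ) ^ (1 - α) ≤ 1 + x ^ δ := by
    refine (Real.rpow_le_rpow (by positivity) hupn h1α.le).trans ?_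
    refine (Real.rpow_add_le_add_rpow zero_le_one (by positivity) h1α.le (by linarith)).trans_eq ?_
    rw [Real.one_rpow, ← Real.rpow_mul hx0.le]
  have hpos : 0 ≤ growth f (m (n + 1)) * Real.exp (-(1 / 2 *
      ∑ l ∈ Finset.range (edgeCount m n), 1 / weightBound α m l)) :=
    mul_nonneg (Finset.prod_nonneg fun l _ => by rw [hf]; positivity) (Real.exp_pos _).le
  rw [Real.norm_of_nonneg hpos]
  have hrhs : 1 / ((n + 1 : ℕ) : ℝ) ^ (2 : ℝ) = Real.exp (-(2 * x)) := by
    rw [Real.rpow_def_of_pos (by positivity), one_div, ← Real.exp_neg]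
    push_cast
    rw [mul_comm]
  rw [hrhs]
  refine (mul_le_mul_of_nonneg_right hgrow (Real.exp_pos _).le).trans ?_
  rw [← Real.exp_add]
  refine Real.exp_le_exp.2 ?_
  have hpow : x ^ (1 + δ) = x * x ^ δ := by rw [Real.rpow_add hx0, Real.rpow_one]
  have h2 : (m (n + 1) : ℝ) ^ (1 - α) / (1 - α) ≤ 1 / (1 - α) + x ^ δ / (1 - α) := by
    rw [← add_div]
    exact div_le_div_of_nonneg_right hmx h1α.le
  -- Half of `c x ^ (1 + δ)` absorbs `x ^ δ / (1 - α)`, the other half is at least `5 x`.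
  have h3 : x ^ δ / (1 - α) ≤ c / 2 * x ^ (1 + δ) := by
    rw [div_le_iff₀ (by positivity)] at hxc
    rw [hpow, div_le_iff₀ h1α]
    nlinarith [Real.rpow_pos_of_pos hx0 δ]
  have h4 : 5 * x ≤ c / 2 * x ^ (1 + δ) := by
    rw [div_le_iff₀ hc] at hxδ
    rw [hpow]
    nlinarith
  have h5 : c * x ^ (1 + δ) - c * Real.log 2 ^ (1 + δ) ≤
      ∑ l ∈ Finset.range (edgeCount m n), 1 / weightBound α m l := by
    rw [← mul_sub]; exact hlower
  have h6 : c * Real.log 2 ^ (1 + δ) + 1 / (1 - α) ≤ x := hxK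
  linarith

lemma tendsto_sum_inv_weightBound {α ν : ℝ} (hα' : α < 1) (hν : 0 < ν) {m : ℕ → ℕ}
    (hm : ∀ n, 1 ≤ n → 1 ≤ m n) (hlow : ∀ n : ℕ, 1 ≤ n → Real.log n ^ ν ≤ m n) :
    Tendsto (fun k => ∑ l ∈ Finset.range k, 1 / weightBound α m l) atTop atTop := by
  have hδ : 0 < ν * (1 - α) := mul_pos hν (by linarith)
  have hmono : Monotone fun k => ∑ l ∈ Finset.range k, 1 / weightBound α m l :=
    monotone_nat_of_le_succ fun k => by
      rw [Finset.sum_range_succ, le_add_iff_nonneg_right, weightBound]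
      positivity
  have hlog : Tendsto (fun n : ℕ => Real.log ((n : ℝ) + 1)) atTop atTop :=
    Real.tendsto_log_atTop.comp
      (tendsto_atTop_add_const_right _ _ tendsto_natCast_atTop_atTop)
  have hlim : Tendsto (fun n : ℕ => 1 / (6 * (1 + ν * (1 - α)) * 2 ^ (ν * (1 - α))) *
      (Real.log (n + 1) ^ (1 + ν * (1 - α)) - Real.log 2 ^ (1 + ν * (1 - α)))) atTop atTop :=
    (tendsto_atTop_add_const_right _ _
      ((tendsto_rpow_atTop (by linarith)).comp hlog)).const_mul_atTop (by positivity)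
  refine tendsto_atTop_atTop_of_monotone hmono fun b => ?_
  obtain ⟨n, hn, hn1⟩ := ((hlim.eventually_ge_atTop b).and (eventually_ge_atTop 1)).exists
  exact ⟨edgeCount m n, hn.trans (le_sum_inv_weightBound hα' hν hm hlow hn1)⟩

/-! ### The inverse of `Φ₁` -/

lemma exists_phiOne_eq {f : ℕ → ℝ} (hf : ∀ k, 0 < f k)
    (hdiv : Tendsto (fun k => ∑ l ∈ Finset.range k, 1 / f l) atTop atTop) {y : ℝ} (hy : 0 ≤ y) :
    ∃ x ∈ Set.Ici (0 : ℝ), phiOne f x = y := by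
  classical
  have hex : ∃ k, y < ∑ l ∈ Finset.range k, 1 / f l := (hdiv.eventually_gt_atTop y).exists
  obtain ⟨l, hl⟩ : ∃ l, Nat.find hex = l + 1 := by
    refine Nat.exists_eq_succ_of_ne_zero fun h => ?_
    have := Nat.find_spec hex
    rw [h, Finset.range_zero, Finset.sum_empty] at this
    linarith
  have h1 : y < ∑ i ∈ Finset.range l, 1 / f i + 1 / f l := by
    have := Nat.find_spec hex
    rwa [hl, Finset.sum_range_succ] at this
  have h2 : ∑ i ∈ Finset.range l, 1 / f i ≤ y :=
    not_lt.1 (Nat.find_min hex (by omega))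
  set s := ∑ i ∈ Finset.range l, 1 / f i
  have hu0 : 0 ≤ (y - s) * f l := mul_nonneg (by linarith) (hf l).le
  have hu1 : (y - s) * f l < 1 := by
    rw [← lt_div_iff₀ (hf l)]
    linarith
  have hfloor : ⌊(l : ℝ) + (y - s) * f l⌋₊ = l := by
    rw [Nat.floor_eq_iff (by positivity)]
    constructor <;> linarith
  refine ⟨l + (y - s) * f l, add_nonneg (Nat.cast_nonneg l) hu0, ?_⟩
  rw [phiOne, hfloor, add_sub_cancel_left, mul_div_cancel_right₀ _ (hf l).ne']
  change s + (y - s) = y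
  ring

lemma le_phiOne {α : ℝ} (hα : 0 ≤ α) {f : ℕ → ℝ} (hf : ∀ k : ℕ, f k = ((k : ℝ) + 1) ^ α) {x : ℝ}
    (hx : 0 ≤ x) : x / (x + 1) ^ α ≤ phiOne f x := by
  set l := ⌊x⌋₊
  have hl : (l : ℝ) ≤ x := Nat.floor_le hx
  have hfl : f l ≤ (x + 1) ^ α := by
    rw [hf]
    exact Real.rpow_le_rpow (by positivity) (by linarith) hα
  have hflpos : 0 < f l := by rw [hf]; positivity
  have h1 : (l : ℝ) * (1 / f l) ≤ ∑ i ∈ Finset.range l, 1 / f i := by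
    have := Finset.card_nsmul_le_sum (Finset.range l) (fun i => 1 / f i) (1 / f l) fun i hi => by
      have hil : i ≤ l := (Finset.mem_range.1 hi).le
      refine one_div_le_one_div_of_le (by rw [hf]; positivity) ?_
      rw [hf, hf]
      exact Real.rpow_le_rpow (by positivity) (by
        have : (i : ℝ) ≤ l := by exact_mod_cast hil
        linarith) hα
    simpa using this
  have h2 : x / (x + 1) ^ α ≤ x / f l := div_le_div_of_nonneg_left hx hflpos hfl
  have h3 : x / f l = (l : ℝ) * (1 / f l) + (x - l) / f l := by
    field_simp
    ring
  rw [phiOne]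
  linarith

lemma tendsto_sum_one_div {α : ℝ} (hα : 0 ≤ α) (hα' : α < 1) {f : ℕ → ℝ}
    (hf : ∀ k : ℕ, f k = ((k : ℝ) + 1) ^ α) :
    Tendsto (fun k => ∑ l ∈ Finset.range k, 1 / f l) atTop atTop := by
  have h1 : Tendsto (fun k : ℕ => (k : ℝ) ^ (1 - α)) atTop atTop :=
    (tendsto_rpow_atTop (by linarith)).comp tendsto_natCast_atTop_atTop
  refine tendsto_atTop_mono' _ ?_ h1
  filter_upwards [eventually_ge_atTop 1] with k hk
  have hk0 : (0 : ℝ) < k := by exact_mod_cast hk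
  have := Finset.card_nsmul_le_sum (Finset.range k) (fun i => 1 / f i) (1 / (k : ℝ) ^ α)
    fun i hi => by
      have hil : (i : ℝ) + 1 ≤ k := by exact_mod_cast Finset.mem_range.1 hi
      rw [hf]
      exact one_div_le_one_div_of_le (by positivity) (Real.rpow_le_rpow (by positivity) hil hα)
  rw [Real.rpow_sub hk0, Real.rpow_one]
  simpa [div_eq_mul_inv] using this

/-- The inverse of `Φ₁` takes positive values at `y > 0` and grows at most like
`y ^ (1 / (1 - α))`. -/
lemma phiOneInv_bounds {α : ℝ} (hα : 0 ≤ α) (hα' : α < 1) {f : ℕ → ℝ}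
    (hf : ∀ k : ℕ, f k = ((k : ℝ) + 1) ^ α) {y : ℝ} (hy : 0 < y) :
    0 < phiOneInv f y ∧ phiOneInv f y ≤ 1 + (2 * y) ^ (1 / (1 - α)) := by
  have hf0 : ∀ k, 0 < f k := fun k => by rw [hf]; positivity
  have hex := exists_phiOne_eq hf0 (tendsto_sum_one_div hα hα' hf) hy.le
  have h0 : (0 : ℝ) ≤ phiOneInv f y := Function.invFunOn_mem hex
  have h1 : phiOne f (phiOneInv f y) = y := Function.invFunOn_eq hex
  set x := phiOneInv f y
  have h1α : 0 < 1 - α := by linarith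
  constructor
  · refine lt_of_le_of_ne h0 fun h => hy.ne ?_
    rw [← h1, ← h]
    simp [phiOne]
  rcases le_total x 1 with hx | hx
  · have : 0 ≤ (2 * y) ^ (1 / (1 - α)) := by positivity
    linarith
  have hx0 : 0 < x := by linarith
  have h2 := le_phiOne hα hf h0
  rw [h1] at h2
  have h3 : (x + 1) ^ α ≤ 2 * x ^ α := by
    refine (Real.rpow_le_rpow (by linarith) (show x + 1 ≤ 2 * x by linarith) hα).trans ?_
    rw [Real.mul_rpow (by norm_num) h0]
    refine mul_le_mul_of_nonneg_right ?_ (by positivity)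
    exact (Real.rpow_le_rpow_of_exponent_le (by norm_num) hα'.le).trans_eq (Real.rpow_one 2)
  have h4 : x ^ (1 - α) ≤ 2 * y := by
    rw [div_le_iff₀ (by positivity)] at h2
    rw [Real.rpow_sub hx0, Real.rpow_one, div_le_iff₀ (by positivity)]
    nlinarith
  have h5 : x ≤ (2 * y) ^ (1 / (1 - α)) := by
    have := Real.rpow_le_rpow (by positivity) h4 (show 0 ≤ 1 / (1 - α) by positivity)
    rwa [← Real.rpow_mul h0, mul_one_div_cancel h1α.ne', Real.rpow_one] at this
  linarith

lemma tendsto_div_phiOneInv {α ν θ : ℝ} (hα : 0 ≤ α) (hα' : α < 1) (hθ : 0 < θ)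
    (hθν : θ / (1 - α) < ν) {f : ℕ → ℝ} (hf : ∀ k : ℕ, f k = ((k : ℝ) + 1) ^ α) {m : ℕ → ℕ}
    (hlow : ∀ n : ℕ, 1 ≤ n → Real.log n ^ ν ≤ m n) :
    Tendsto (fun n : ℕ => (m n : ℝ) / phiOneInv f (Real.log n ^ θ)) atTop atTop := by
  have h1α : 0 < 1 - α := by linarith
  set β := 1 / (1 - α) with hβ
  have hβ0 : 0 < β := by positivity
  have hlog : Tendsto (fun n : ℕ => Real.log (n : ℝ)) atTop atTop :=
    Real.tendsto_log_atTop.comp tendsto_natCast_atTop_atTop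
  have hlim : Tendsto (fun n : ℕ => Real.log (n : ℝ) ^ (ν - θ * β) / (1 + 2 ^ β)) atTop atTop :=
    ((tendsto_rpow_atTop (by rw [hβ, mul_one_div]; linarith)).comp hlog).atTop_div_const
      (by positivity)
  refine tendsto_atTop_mono' _ ?_ hlim
  filter_upwards [hlog.eventually_ge_atTop 1, eventually_ge_atTop 1] with n hx hn
  have hm := hlow n hn
  set x := Real.log (n : ℝ)
  have hx0 : 0 < x := by linarith
  obtain ⟨h1, h2⟩ := phiOneInv_bounds hα hα' hf (y := x ^ θ) (by positivity)
  have h3 : (2 * x ^ θ) ^ β = 2 ^ β * x ^ (θ * β) := by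
    rw [Real.mul_rpow (by norm_num) (by positivity), ← Real.rpow_mul hx0.le]
  have h4 : 1 ≤ x ^ (θ * β) := Real.one_le_rpow hx (by positivity)
  have h5 : phiOneInv f (x ^ θ) ≤ (1 + 2 ^ β) * x ^ (θ * β) := by
    rw [← hβ, h3] at h2
    linarith
  rw [div_le_div_iff₀ (by positivity) h1, Real.rpow_sub hx0, div_mul_eq_mul_div,
    div_le_iff₀ (by positivity)]
  have h6 := mul_le_mul hm h5 h1.le (Nat.cast_nonneg _)
  linarith

end AttachmentModel

theorem theorem4p5 (α : ℝ) (hα : 1 / 2 < α) (hα' : α < 1) (ν : ℝ) (hν : 0 < ν)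
    (f : ℕ → ℝ) (hf : ∀ k : ℕ, f k = ((k : ℝ) + 1) ^ α)
    (m : ℕ → ℕ) (hm : ∀ n : ℕ, 1 ≤ n → m n = ⌊1 + (Real.log (n : ℝ)) ^ ν⌋₊) :
    (∀ (Ω : Type*) [MeasurableSpace Ω] (μ : MeasureTheory.Measure Ω)
        [MeasureTheory.IsProbabilityMeasure μ] (T : ℕ → Ω → ℕ),
        AttachmentModel.IsAttachmentProcess μ f m T →
        ∀ᵐ ω ∂μ,
          AttachmentModel.HasPersistentHub
            (AttachmentModel.vertexGraph m (fun j => T j ω)) ∧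
          AttachmentModel.HasPersistentHub
            (AttachmentModel.edgeGraph m (fun j => T j ω))) ∧
    (∀ θ : ℝ, 0 < θ → θ / (1 - α) < ν →
      Filter.Tendsto
        (fun n : ℕ => (m n : ℝ) / AttachmentModel.phiOneInv f ((Real.log (n : ℝ)) ^ θ))
        Filter.atTop Filter.atTop) := by
  have hα0 : 0 ≤ α := by linarith
  have hpow : ∀ n : ℕ, 0 ≤ Real.log (n : ℝ) ^ ν := fun n =>
    Real.rpow_nonneg (Real.log_natCast_nonneg n) ν
  have hm1 : ∀ n, 1 ≤ n → 1 ≤ m n := fun n hn => by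
    rw [hm n hn, Nat.one_le_floor_iff]
    linarith [hpow n]
  have hlow : ∀ n : ℕ, 1 ≤ n → Real.log n ^ ν ≤ m n := fun n hn => by
    rw [hm n hn]
    linarith [Nat.lt_floor_add_one (1 + Real.log (n : ℝ) ^ ν)]
  have hup : ∀ n : ℕ, 1 ≤ n → (m n : ℝ) ≤ 1 + Real.log n ^ ν := fun n hn => by
    rw [hm n hn]
    exact Nat.floor_le (by linarith [hpow n])
  have hmono : ∀ i j, 1 ≤ i → i ≤ j → m i ≤ m j := fun i j hi hij => by
    rw [hm i hi, hm j (hi.trans hij)]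
    have h1 : (0 : ℝ) < i := by exact_mod_cast hi
    have h2 : (i : ℝ) ≤ j := by exact_mod_cast hij
    exact Nat.floor_mono (add_le_add le_rfl
      (Real.rpow_le_rpow (Real.log_natCast_nonneg i) (Real.log_le_log h1 h2) hν.le))
  have hf1 : ∀ k, 1 ≤ f k := fun k => by
    rw [hf]
    exact Real.one_le_rpow (by linarith [Nat.cast_nonneg (α := ℝ) k]) hα0
  refine ⟨fun Ω _ μ _ T hT => ?_, fun θ hθ hθν =>
    AttachmentModel.tendsto_div_phiOneInv hα0 hα' hθ hθν hf hlow⟩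
  filter_upwards [AttachmentModel.ae_hasPersistentHub hT hf1 hm1
    (AttachmentModel.summable_one_div_sq hα hf)
    (AttachmentModel.totalWeight_le_weightBound hα0 hα'.le hf hm1 hmono T)
    (AttachmentModel.tendsto_sum_inv_weightBound hα' hν hm1 hlow)
    (AttachmentModel.summable_growth_mul_exp hα0 hα' hν hf hm1 hlow hup)] with ω hω
  exact ⟨AttachmentModel.vertexGraph_hasPersistentHub hm1 hω, hω⟩
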